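/- Let $\psi(x)=\frac{1}{\sqrt{2\pi}}e^{-x^2/2}$, with Fourier transform $\widehat\psi(t)=e^{-2\pi^2t^2}$, and put $A=2+3\widehat\psi(1)$, $\epsilon=2\widehat\psi(2)$. For $h>0$ and a bounded $f:\mathbb R\to\mathbb R$ let $$Q_hf(x)=\sum_{\ell\in\mathbb Z}f(h\ell)\,\psi\!\left(\tfrac xh-\ell\right),\qquad E_hf=f-Q_hf,$$ and define the multilevel error after $p$ levels starting at spacing $h$ by $M_{h,0}f=f$, $M_{h,p}f=E_{h/2^{p-1}}M_{h,p-1}f$ for $p\ge1$. For a square integrable $1$-periodic $f$ let $\widehat f_k=\int_0^1f(x)e^{-2\pi ikx}\,dx$ and $$\|f\|_s=\Big(|\widehat f_0|^2+\sum_{k\in\mathbb Z}|k|^{2s}|\widehat f_k|^2\Big)^{1/2},\qquad W_s=\{f:\|f\|_s<\infty\}.$$ For $\ell\ge2$, $h=2^{-\ell}$, an integer $0\le m<2^{\ell-1}$ and $c_k(x)=\cos(2\pi kx)$, let $$T_{h,p}c_m=\sum_{j=0}^{2^p-1}\Big(\overline\alpha^{(p)}_j\,c_{m-(2^p-j)/h}+\alpha^{(p)}_j\,c_{m+j/h}\Big),\qquad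 \|T_{h,p}c_m\|=\sum_{j=0}^{2^p-1}\big(|\alpha_j^{(p)}|+|\overline\alpha_j^{(p)}|\big)$$ be the central truncation of $M_{h,p}c_m$, where $\overline\alpha^{(1)}_0=-\widehat\psi(hm-2)$, $\overline\alpha^{(1)}_1=-\widehat\psi(hm-1)$, $\alpha^{(1)}_0=1-\widehat\psi(hm)$, $\alpha^{(1)}_1=-\widehat\psi(hm+1)$ and, for $p\ge1$ and $0\le j<2^p$, with $\sigma_j=\overline\alpha^{(p)}_j+\alpha^{(p)}_j$ and $y_j=(hm+j)/2^p$, $$\overline\alpha^{(p+1)}_j=-\sigma_j\widehat\psi(y_j-2),\quad \overline\alpha^{(p+1)}_{2^p+j}=\overline\alpha^{(p)}_j-\sigma_j\widehat\psi(y_j-1),\quad \alpha^{(p+1)}_j=\alpha^{(p)}_j-\sigma_j\widehat\psi(y_j),\quad \alpha^{(p+1)}_{2^p+j}=-\sigma_j\widehat\psi(y_j+1).$$ **Theorem.** There is a constant $B>0$, independent of $m$ and $\ell$, such that $$\|T_{h,p}c_m\|\le B(0.9)^p\qquad\text{for all }\ell\ge2,\ h=2^{-\ell},\ 0\le m<2^{\ell-1},\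 p\ge3.\tag{$*$}$$ For every $B$ satisfying $(*)$, all real $s\ge1$ and $\tfrac12<t<s$, every continuous even $1$-periodic $f:\mathbb R\to\mathbb R$ in $W_s$ and every $p\ge1$, $$\|M_{1,p}f\|_\infty\le\Big(31B\,(1+D(s))\,(0.9)^p+C(t)\,A^p\,2^{-(p-2)(s-t)}+\frac{2}{\sqrt3}\,p^{3/2}A^p\epsilon\Big)\|f\|_s,$$ where $$D(s)=\Big(\sum_{\ell=0}^{p-3}(0.9)^{-2\ell-4}\,2^{-2\ell(s-1/2)}\Big)^{1/2},\qquad C(t)=\Big(\sum_{k\in\mathbb N,\;k\ge2^{p-2}}k^{-2t}\Big)^{1/2}$$ (an empty sum is $0$). -/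

import Mathlib

open MeasureTheory FourierTransform

noncomputable section

namespace GaussianMultilevel

/-- The Gaussian `ψ(x) = (2π)^{-1/2} exp(-x²/2)`. -/
def psi (x : ℝ) : ℝ := 1 / Real.sqrt (2 * Real.pi) * Real.exp (-x ^ 2 / 2)

/-- The Fourier transform of `psi`, `exp(-2π²t²)` (see `fourier_psi`). -/
def psiHat (t : ℝ) : ℝ := Real.exp (-2 * Real.pi ^ 2 * t ^ 2)

theorem fourier_psi (t : ℝ) : 𝓕 (fun x : ℝ => (psi x : ℂ)) t = (psiHat t : ℂ) := by
  have hb : 0 < ((1 / (2 * Real.pi) : ℝ) : ℂ).re := by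
    rw [Complex.ofReal_re]; positivity
  have key := congrFun (fourier_gaussian_pi hb) t
  have hpi : (Real.pi : ℂ) ≠ 0 := by exact_mod_cast Real.pi_ne_zero
  have hfun : (fun x : ℝ => (psi x : ℂ)) =
      (((1 / Real.sqrt (2 * Real.pi) : ℝ) : ℂ)) •
        (fun x : ℝ => Complex.exp (-Real.pi * ((1 / (2 * Real.pi) : ℝ) : ℂ) * x ^ 2)) := by
    funext x
    simp only [psi, Pi.smul_apply, smul_eq_mul]
    push_cast
    congr 2
    field_simp
  have hs : 𝓕 ((((1 / Real.sqrt (2 * Real.pi) : ℝ) : ℂ)) •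
        (fun x : ℝ => Complex.exp (-Real.pi * ((1 / (2 * Real.pi) : ℝ) : ℂ) * x ^ 2))) t
      = ((1 / Real.sqrt (2 * Real.pi) : ℝ) : ℂ) *
        𝓕 (fun x : ℝ => Complex.exp (-Real.pi * ((1 / (2 * Real.pi) : ℝ) : ℂ) * x ^ 2)) t := by
    simp only [Real.fourier_eq', Pi.smul_apply, smul_eq_mul]
    rw [← integral_const_mul]
    congr 1
    funext x
    ring
  rw [hfun, hs, key]
  have h1 : (((1 / (2 * Real.pi) : ℝ) : ℂ)) ^ (1 / 2 : ℂ)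
      = ((1 / Real.sqrt (2 * Real.pi) : ℝ) : ℂ) := by
    rw [show (1 / 2 : ℂ) = ((1 / 2 : ℝ) : ℂ) by push_cast; ring,
      ← Complex.ofReal_cpow (by positivity), ← Real.sqrt_eq_rpow, Real.sqrt_div zero_le_one,
      Real.sqrt_one]
  rw [h1]
  have h2 : ((1 / Real.sqrt (2 * Real.pi) : ℝ) : ℂ) ≠ 0 := by
    rw [Ne, Complex.ofReal_eq_zero]; positivity
  rw [← mul_assoc, mul_one_div_cancel h2, one_mul, psiHat]
  push_cast
  congr 1
  field_simp

/-- `A = 2 + 3 ψ̂(1)`. -/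
def constA : ℝ := 2 + 3 * psiHat 1

/-- `ε = 2 ψ̂(2)`. -/
def eps : ℝ := 2 * psiHat 2

/-! ### Quasi-interpolation and the multilevel error -/

/-- The stationary quasi-interpolant `Q_h f(x) = ∑_{l ∈ ℤ} f(h l) ψ(x / h - l)`; the series converges
absolutely for every bounded `f`. -/
def quasiInterp (h : ℝ) (f : ℝ → ℝ) (x : ℝ) : ℝ := ∑' l : ℤ, f (h * l) * psi (x / h - l)

/-- `E_h f = f - Q_h f`. -/
def quasiError (h : ℝ) (f : ℝ → ℝ) : ℝ → ℝ := fun x => f x - quasiInterp h f x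

/-- The multilevel error `M_{h,p}`: `M_{h,0} f = f` and `M_{h,p} f = E_{h / 2^(p-1)} (M_{h,p-1} f)`. -/
def multilevelError (h : ℝ) : ℕ → (ℝ → ℝ) → ℝ → ℝ
  | 0, f => f
  | p + 1, f => quasiError (h / 2 ^ p) (multilevelError h p f)

/-! ### Periodic Sobolev spaces -/

/-- `f̂_k = ∫₀¹ f(x) exp(-2πikx) dx`. -/
def fourierCoef (f : ℝ → ℝ) (k : ℤ) : ℂ :=
  ∫ x in (0 : ℝ)..1, (f x : ℂ) * Complex.exp (-2 * Real.pi * Complex.I * k * x)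

/-- Membership in the periodic Sobolev space `W_s` (used for `s > 0`). -/
def MemSobolev (s : ℝ) (f : ℝ → ℝ) : Prop :=
  Function.Periodic f 1 ∧ MemLp f 2 (volume.restrict (Set.Ioc (0 : ℝ) 1)) ∧
    Summable fun k : ℤ => |(k : ℝ)| ^ (2 * s) * ‖fourierCoef f k‖ ^ 2

/-- `‖f‖_s = (|f̂_0|² + ∑_{k ∈ ℤ} |k|^{2s} |f̂_k|²)^{1/2}`. -/
def sobolevNorm (s : ℝ) (f : ℝ → ℝ) : ℝ :=
  Real.sqrt (‖fourierCoef f 0‖ ^ 2 + ∑' k : ℤ, |(k : ℝ)| ^ (2 * s) * ‖fourierCoef f k‖ ^ 2)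

/-! ### The central truncation of the multilevel error of a cosine

For `c_m(x) = cos (2πmx)`, spacing `h` and `y = h m`, the truncation at level `p` is
`T_{h,p} c_m = ∑_{j < 2^p} (ᾱ_j^{(p)} c_{m - (2^p - j)/h} + α_j^{(p)} c_{m + j/h})`. -/

/-- The pair of coefficient sequences `(ᾱ^{(p)}, α^{(p)})`, of which the entries with index `j < 2^p`
are used. At `p = 0` it represents `T_{h,0} c_m = c_m`; see `truncCoeff_one` for `p = 1`. -/
def truncCoeff (y : ℝ) : ℕ → (ℕ → ℝ) × (ℕ → ℝ)
  | 0 => (fun _ => 0, fun _ => 1)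
  | p + 1 =>
    let b := (truncCoeff y p).1
    let a := (truncCoeff y p).2
    (fun i =>
      if i < 2 ^ p then -(b i + a i) * psiHat ((y + i) / 2 ^ p - 2)
      else b (i - 2 ^ p)
        - (b (i - 2 ^ p) + a (i - 2 ^ p)) * psiHat ((y + (i - 2 ^ p : ℕ)) / 2 ^ p - 1),
     fun i =>
      if i < 2 ^ p then a i - (b i + a i) * psiHat ((y + i) / 2 ^ p)
      else -(b (i - 2 ^ p) + a (i - 2 ^ p)) * psiHat ((y + (i - 2 ^ p : ℕ)) / 2 ^ p + 1))

/-- The level-one coefficients. -/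
theorem truncCoeff_one (y : ℝ) :
    (truncCoeff y 1).1 0 = -psiHat (y - 2) ∧ (truncCoeff y 1).1 1 = -psiHat (y - 1) ∧
    (truncCoeff y 1).2 0 = 1 - psiHat y ∧ (truncCoeff y 1).2 1 = -psiHat (y + 1) := by
  simp [truncCoeff]

/-- `‖T_{h,p} c_m‖ = ∑_{j < 2^p} (|α_j^{(p)}| + |ᾱ_j^{(p)}|)`, with `y = h m`. -/
def truncNorm (y : ℝ) (p : ℕ) : ℝ :=
  ∑ j ∈ Finset.range (2 ^ p), (|(truncCoeff y p).2 j| + |(truncCoeff y p).1 j|)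

/-- `B` is a truncation constant, independent of `m` and `ℓ`: `‖T_{h,p} c_m‖ ≤ B (0.9)^p` for all
`ℓ ≥ 2`, `h = 2^{-ℓ}`, `0 ≤ m < 2^{ℓ-1}` and `p ≥ 3`. -/
def IsTruncConst (B : ℝ) : Prop :=
  ∀ l : ℕ, 2 ≤ l → ∀ m : ℕ, m < 2 ^ (l - 1) → ∀ p : ℕ, 3 ≤ p →
    truncNorm (1 / 2 ^ l * m) p ≤ B * 0.9 ^ p

/-! ### The two quantities in the error bound -/

/-- `D(s) = (∑_{l=0}^{p-3} (0.9)^{-2l-4} 2^{-2l(s-1/2)})^{1/2}`, the sum being empty if `p < 3`. -/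
def constD (p : ℕ) (s : ℝ) : ℝ :=
  Real.sqrt (∑ l ∈ Finset.range (p - 2),
    ((0.9 : ℝ) ^ (2 * l + 4))⁻¹ * (2 : ℝ) ^ (-2 * (l : ℝ) * (s - 1 / 2)))

/-- `C(t) = (∑_{k ≥ 2^{p-2}} k^{-2t})^{1/2}`, over the integers `k ≥ 2^{p-2}`. -/
def constC (p : ℕ) (t : ℝ) : ℝ :=
  Real.sqrt (∑' k : ℕ, if (2 : ℝ) ^ ((p : ℤ) - 2) ≤ k then (k : ℝ) ^ (-2 * t) else 0)

end GaussianMultilevel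

end

open GaussianMultilevel

namespace GaussianMultilevel

/-- The cosine `c_k(x) = cos (2πkx)` of real frequency `k`. -/
noncomputable def cosMode (k x : ℝ) : ℝ := Real.cos (2 * Real.pi * k * x)

theorem abs_cosMode_le (k x : ℝ) : |cosMode k x| ≤ 1 := Real.abs_cos_le_one _

theorem psi_nonneg (x : ℝ) : 0 ≤ psi x := by unfold psi; positivity

theorem psiHat_pos (x : ℝ) : 0 < psiHat x := Real.exp_pos _

theorem psiHat_nonneg (x : ℝ) : 0 ≤ psiHat x := (psiHat_pos x).le

theorem psiHat_neg (x : ℝ) : psiHat (-x) = psiHat x := by simp [psiHat]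

theorem psiHat_zero : psiHat 0 = 1 := by simp [psiHat]

theorem psiHat_le_one (x : ℝ) : psiHat x ≤ 1 := by
  unfold psiHat
  rw [Real.exp_le_one_iff]
  nlinarith [mul_nonneg (sq_nonneg Real.pi) (sq_nonneg x)]

theorem psiHat_le_of_sq_le {x y : ℝ} (h : y ^ 2 ≤ x ^ 2) : psiHat x ≤ psiHat y := by
  unfold psiHat
  apply Real.exp_le_exp.2
  nlinarith [mul_le_mul_of_nonneg_left h (sq_nonneg Real.pi)]

theorem psiHat_anti {x y : ℝ} (hy : 0 ≤ y) (h : y ≤ x) : psiHat x ≤ psiHat y :=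
  psiHat_le_of_sq_le (by gcongr)

theorem psiHat_mul (x y : ℝ) : psiHat x * psiHat y = Real.exp (-2 * Real.pi ^ 2 * (x ^ 2 + y ^ 2)) := by
  unfold psiHat
  rw [← Real.exp_add]; ring_nf

/-- The series of translates of the Gaussian, with its phase, is a theta series. -/
theorem psi_mul_exp_eq (y u : ℝ) (l : ℤ) :
    (psi (u - l) : ℂ) * Complex.exp (2 * Real.pi * Complex.I * (y * l)) =
      (1 / Real.sqrt (2 * Real.pi) * Real.exp (-u ^ 2 / 2) : ℝ) *
        Complex.exp (-Real.pi * (1 / (2 * Real.pi) : ℝ) * l ^ 2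
          + 2 * Real.pi * (u / (2 * Real.pi) + Complex.I * y) * l) := by
  have hpi : (Real.pi : ℂ) ≠ 0 := by exact_mod_cast Real.pi_ne_zero
  unfold psi
  push_cast
  rw [mul_assoc (1 / _) (Complex.exp _), mul_assoc (1 / _) (Complex.exp _), ← Complex.exp_add,
    ← Complex.exp_add]
  congr 2
  field_simp
  ring

theorem summable_psi (u : ℝ) : Summable fun l : ℤ => psi (u - l) := by
  have h := (summable_jacobiTheta₂_term_iff (-Complex.I * u / (2 * Real.pi))
    (Complex.I / (2 * Real.pi))).2 (by
      have : Complex.I / (2 * Real.pi) = ((1 / (2 * Real.pi) : ℝ) : ℂ) * Complex.I := by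
        push_cast; ring
      rw [this, Complex.im_ofReal_mul, Complex.I_im]
      positivity)
  have h2 := (h.mul_left ((1 / Real.sqrt (2 * Real.pi) * Real.exp (-u ^ 2 / 2) : ℝ) : ℂ))
  rw [← Complex.summable_ofReal]
  refine h2.congr fun l => ?_
  have hpi : (Real.pi : ℂ) ≠ 0 := by exact_mod_cast Real.pi_ne_zero
  have := psi_mul_exp_eq 0 u l
  simp only [Complex.ofReal_zero, zero_mul, mul_zero, Complex.exp_zero, mul_one, add_zero] at this
  rw [this, jacobiTheta₂_term]
  congr 2
  push_cast
  field_simp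
  ring_nf
  simp only [Complex.I_sq]
  ring

theorem summable_mul_psi {g : ℤ → ℝ} {C : ℝ} (hg : ∀ l, |g l| ≤ C) (u : ℝ) :
    Summable fun l : ℤ => g l * psi (u - l) := by
  refine Summable.of_norm_bounded ((summable_psi u).mul_left C) fun l => ?_
  rw [Real.norm_eq_abs, abs_mul, abs_of_nonneg (psi_nonneg _)]
  exact mul_le_mul_of_nonneg_right (hg l) (psi_nonneg _)

theorem tsum_psi_mul_exp (y u : ℝ) :
    ∑' l : ℤ, (psi (u - l) : ℂ) * Complex.exp (2 * Real.pi * Complex.I * (y * l)) =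
      ∑' n : ℤ, (psiHat (y + n) : ℂ) * Complex.exp (2 * Real.pi * Complex.I * ((y + n) * u)) := by
  have hpi : (Real.pi : ℂ) ≠ 0 := by exact_mod_cast Real.pi_ne_zero
  simp_rw [psi_mul_exp_eq]
  rw [tsum_mul_left, Complex.tsum_exp_neg_quadratic (by rw [Complex.ofReal_re]; positivity)]
  have h1 : (((1 / (2 * Real.pi) : ℝ) : ℂ)) ^ (1 / 2 : ℂ)
      = ((1 / Real.sqrt (2 * Real.pi) : ℝ) : ℂ) := by
    rw [show (1 / 2 : ℂ) = ((1 / 2 : ℝ) : ℂ) by push_cast; ring,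
      ← Complex.ofReal_cpow (by positivity), ← Real.sqrt_eq_rpow, Real.sqrt_div zero_le_one,
      Real.sqrt_one]
  have h2 : ((1 / Real.sqrt (2 * Real.pi) : ℝ) : ℂ) ≠ 0 := by
    rw [Ne, Complex.ofReal_eq_zero]; positivity
  have h3 : ((1 / Real.sqrt (2 * Real.pi) * Real.exp (-u ^ 2 / 2) : ℝ) : ℂ) *
      (1 / ((1 / Real.sqrt (2 * Real.pi) : ℝ) : ℂ)) = Complex.exp (-u ^ 2 / 2) := by
    rw [Complex.ofReal_mul, mul_comm ((1 / Real.sqrt (2 * Real.pi) : ℝ) : ℂ), mul_assoc,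
      mul_one_div_cancel h2, mul_one]
    push_cast; rfl
  rw [h1, ← mul_assoc, h3, ← tsum_mul_left, ← (Equiv.neg ℤ).tsum_eq]
  refine tsum_congr fun n => ?_
  rw [psiHat, ← Complex.exp_add, Complex.ofReal_exp, ← Complex.exp_add, Equiv.neg_apply]
  congr 1
  push_cast
  field_simp
  ring_nf
  simp only [Complex.I_sq, Complex.I_pow_three, Complex.I_pow_four]
  ring

theorem summable_psiHat (y : ℝ) : Summable fun n : ℤ => psiHat (y + n) := by
  have h := (summable_jacobiTheta₂_term_iff (2 * Real.pi * y * Complex.I)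
    (2 * Real.pi * Complex.I)).2 (by
      have : (2 * Real.pi * Complex.I) = ((2 * Real.pi : ℝ) : ℂ) * Complex.I := by push_cast; ring
      rw [this, Complex.im_ofReal_mul, Complex.I_im]
      positivity)
  have h2 := h.mul_left ((Real.exp (-2 * Real.pi ^ 2 * y ^ 2) : ℝ) : ℂ)
  rw [← Complex.summable_ofReal]
  refine h2.congr fun n => ?_
  rw [jacobiTheta₂_term, psiHat, Complex.ofReal_exp, Complex.ofReal_exp, ← Complex.exp_add]
  congr 1
  push_cast
  ring_nf
  simp only [Complex.I_sq]
  ring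

/-- Poisson summation: the quasi-interpolant of a cosine. -/
theorem hasSum_quasiInterp_cosMode {h : ℝ} (hh : h ≠ 0) (k x : ℝ) :
    HasSum (fun n : ℤ => psiHat (h * k + n) * cosMode (k + n / h) x)
      (quasiInterp h (cosMode k) x) := by
  have key := tsum_psi_mul_exp (h * k) (x / h)
  have e1 : ∀ l : ℤ, ((psi (x / h - l) : ℂ) *
      Complex.exp (2 * Real.pi * Complex.I * ((h * k : ℝ) * l))).re
      = cosMode k (h * l) * psi (x / h - l) := by
    intro l
    rw [show (2 * Real.pi * Complex.I * ((h * k : ℝ) * l) : ℂ)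
      = ((2 * Real.pi * k * (h * l) : ℝ) : ℂ) * Complex.I by push_cast; ring,
      Complex.re_ofReal_mul, Complex.exp_ofReal_mul_I_re, cosMode]
    ring
  have e2 : ∀ n : ℤ, ((psiHat (h * k + n) : ℂ) *
      Complex.exp (2 * Real.pi * Complex.I * (((h * k : ℝ) + n) * (x / h : ℝ)))).re
      = psiHat (h * k + n) * cosMode (k + n / h) x := by
    intro n
    rw [show (2 * Real.pi * Complex.I * (((h * k : ℝ) + n) * (x / h : ℝ)) : ℂ)
      = ((2 * Real.pi * (k + n / h) * x : ℝ) : ℂ) * Complex.I by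
        have : (h : ℂ) ≠ 0 := by exact_mod_cast hh
        push_cast; field_simp,
      Complex.re_ofReal_mul, Complex.exp_ofReal_mul_I_re, cosMode]
  have s1 : Summable fun l : ℤ => (psi (x / h - l) : ℂ) *
      Complex.exp (2 * Real.pi * Complex.I * ((h * k : ℝ) * l)) := by
    refine Summable.of_norm_bounded (summable_psi (x / h)) fun l => le_of_eq ?_
    rw [show (2 * Real.pi * Complex.I * ((h * k : ℝ) * l) : ℂ)
      = ((2 * Real.pi * k * (h * l) : ℝ) : ℂ) * Complex.I by push_cast; ring,
      norm_mul, Complex.norm_exp_ofReal_mul_I, mul_one, Complex.norm_real, Real.norm_eq_abs,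
      abs_of_nonneg (psi_nonneg _)]
  have s2 : Summable fun n : ℤ => (psiHat (h * k + n) : ℂ) *
      Complex.exp (2 * Real.pi * Complex.I * (((h * k : ℝ) + n) * (x / h : ℝ))) := by
    refine Summable.of_norm_bounded (summable_psiHat (h * k)) fun n => le_of_eq ?_
    rw [show (2 * Real.pi * Complex.I * (((h * k : ℝ) + n) * (x / h : ℝ)) : ℂ)
      = ((2 * Real.pi * (h * k + n) * (x / h) : ℝ) : ℂ) * Complex.I by push_cast; ring,
      norm_mul, Complex.norm_exp_ofReal_mul_I, mul_one, Complex.norm_real, Real.norm_eq_abs,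
      abs_of_nonneg (psiHat_nonneg _)]
  have r1 := Complex.hasSum_re s1.hasSum
  have r2 := Complex.hasSum_re s2.hasSum
  rw [← key] at r2
  have : quasiInterp h (cosMode k) x = _ := (by simpa only [e1] using r1 :
    HasSum (fun l : ℤ => cosMode k (h * l) * psi (x / h - l)) _).tsum_eq
  rw [this]
  simpa only [e2] using r2

theorem psiHat_le_inv_pow (t : ℝ) {n : ℕ} (hn : n ≠ 0) :
    psiHat t ≤ ((1 + 2 * 3.1415 ^ 2 * t ^ 2 / n) ^ n)⁻¹ := by
  have hn' : (0 : ℝ) < n := by positivity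
  have h1 : 1 + 2 * 3.1415 ^ 2 * t ^ 2 / n ≤ Real.exp (2 * Real.pi ^ 2 * t ^ 2 / n) := by
    have := Real.add_one_le_exp (2 * Real.pi ^ 2 * t ^ 2 / n)
    have h3 : (2 : ℝ) * 3.1415 ^ 2 * t ^ 2 / n ≤ 2 * Real.pi ^ 2 * t ^ 2 / n := by
      gcongr
      exact Real.pi_gt_d4.le
    linarith
  have h2 := pow_le_pow_left₀ (by positivity) h1 n
  rw [← Real.exp_nat_mul, mul_div_cancel₀ _ hn'.ne'] at h2
  unfold psiHat
  rw [show -2 * Real.pi ^ 2 * t ^ 2 = -(2 * Real.pi ^ 2 * t ^ 2) by ring, Real.exp_neg]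
  exact inv_anti₀ (by positivity) h2

theorem pow_le_psiHat (t : ℝ) {n : ℕ} (hn : n ≠ 0) (h : 2 * 3.1416 ^ 2 * t ^ 2 ≤ n) :
    (1 - 2 * 3.1416 ^ 2 * t ^ 2 / n) ^ n ≤ psiHat t := by
  have hn' : (0 : ℝ) < n := by positivity
  have h1 : 1 - 2 * 3.1416 ^ 2 * t ^ 2 / n ≤ Real.exp (-(2 * Real.pi ^ 2 * t ^ 2 / n)) := by
    have := Real.add_one_le_exp (-(2 * Real.pi ^ 2 * t ^ 2 / n))
    have h3 : 2 * Real.pi ^ 2 * t ^ 2 / n ≤ (2 : ℝ) * 3.1416 ^ 2 * t ^ 2 / n := by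
      gcongr
      exact Real.pi_lt_d4.le
    linarith
  have h0 : 0 ≤ 1 - 2 * 3.1416 ^ 2 * t ^ 2 / n := by
    rw [sub_nonneg, div_le_one hn']; exact h
  have h2 := pow_le_pow_left₀ h0 h1 n
  rw [← Real.exp_nat_mul, mul_neg, mul_div_cancel₀ _ hn'.ne'] at h2
  unfold psiHat
  rwa [show -2 * Real.pi ^ 2 * t ^ 2 = -(2 * Real.pi ^ 2 * t ^ 2) by ring]

theorem psiHat_one_le : psiHat 1 ≤ 1 / 1000000 :=
  (psiHat_le_inv_pow 1 (n := 128) (by norm_num)).trans (by norm_num)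

theorem psiHat_half_le : psiHat (1 / 2) ≤ 13 / 1000 :=
  (psiHat_le_inv_pow _ (n := 32) (by norm_num)).trans (by norm_num)

theorem psiHat_three_quarters_le : psiHat (3 / 4) ≤ 1 / 10000 :=
  (psiHat_le_inv_pow _ (n := 64) (by norm_num)).trans (by norm_num)

theorem le_psiHat_quarter : 2886 / 10000 ≤ psiHat (1 / 4) :=
  le_trans (by norm_num) (pow_le_psiHat _ (n := 128) (by norm_num) (by norm_num))

theorem le_psiHat_eighth : 65 / 100 ≤ psiHat (1 / 8) :=
  le_trans (by norm_num) (pow_le_psiHat _ (n := 8) (by norm_num) (by norm_num))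

theorem psiHat_two_le : psiHat 2 ≤ 1 / 1000000 * psiHat 1 := by
  have h : psiHat 2 ≤ psiHat 1 * psiHat 1 := by
    rw [psiHat_mul, psiHat]
    apply Real.exp_le_exp.2
    nlinarith [sq_nonneg Real.pi]
  nlinarith [psiHat_one_le, psiHat_nonneg 1]

theorem constA_ge_two : 2 ≤ constA := by
  unfold constA; linarith [psiHat_nonneg 1]

theorem constA_le : constA ≤ 2 + 3 / 1000000 := by
  unfold constA; linarith [psiHat_one_le]

/-- The translates of `psiHat` decay geometrically. -/
theorem psiHat_add_nat_le {z : ℝ} (hz : 0 ≤ z) (n : ℕ) :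
    psiHat (z + n) ≤ psiHat z * (1 / 1000000) ^ n := by
  have h1 : psiHat (z + n) ≤ psiHat z * psiHat 1 ^ n := by
    unfold psiHat
    rw [← Real.exp_nat_mul, ← Real.exp_add]
    apply Real.exp_le_exp.2
    have hn : (n : ℝ) ≤ (n : ℝ) ^ 2 := by exact_mod_cast Nat.le_self_pow two_ne_zero n
    have : z ^ 2 + n ≤ (z + n) ^ 2 := by nlinarith [mul_nonneg hz (Nat.cast_nonneg (α := ℝ) n)]
    nlinarith [mul_le_mul_of_nonneg_left this (sq_nonneg Real.pi)]
  refine h1.trans (mul_le_mul_of_nonneg_left ?_ (psiHat_nonneg z))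
  exact pow_le_pow_left₀ (psiHat_nonneg 1) psiHat_one_le n

theorem abs_tsum_tail_le {z : ℝ} (hz : 0 ≤ z) {g : ℕ → ℝ} (hg : ∀ n : ℕ, |g n| ≤ psiHat (z + n)) :
    |∑' n, g n| ≤ 1000000 / 999999 * psiHat z := by
  have hs : HasSum (fun n : ℕ => psiHat z * (1 / 1000000 : ℝ) ^ n)
      (psiHat z * (1 - 1 / 1000000)⁻¹) :=
    (hasSum_geometric_of_lt_one (by norm_num) (by norm_num)).mul_left _
  have := tsum_of_norm_bounded (f := g) hs fun n => (hg n).trans (psiHat_add_nat_le hz n)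
  rw [Real.norm_eq_abs] at this
  refine this.trans (le_of_eq ?_)
  norm_num
  ring

/-- The quasi-interpolant of a cosine is given by its four central frequencies, up to a tiny error. -/
theorem abs_quasiInterp_cosMode_sub_le {h k : ℝ} (hh : h ≠ 0) (h0 : 0 ≤ h * k) (h1 : h * k ≤ 1)
    (x : ℝ) :
    |quasiInterp h (cosMode k) x -
      (psiHat (h * k - 2) * cosMode (k - 2 / h) x + psiHat (h * k - 1) * cosMode (k - 1 / h) x
        + psiHat (h * k) * cosMode k x + psiHat (h * k + 1) * cosMode (k + 1 / h) x)|
      ≤ 11 / 10 * psiHat 2 := by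
  set g : ℤ → ℝ := fun n => psiHat (h * k + n) * cosMode (k + n / h) x with hg
  have hgle : ∀ n : ℤ, |g n| ≤ psiHat (h * k + n) := fun n => by
    rw [hg, abs_mul, abs_of_nonneg (psiHat_nonneg _)]
    exact mul_le_of_le_one_right (psiHat_nonneg _) (abs_cosMode_le _ _)
  have hs := hasSum_quasiInterp_cosMode hh k x
  have hpos : Summable fun n : ℕ => g n := hs.summable.comp_injective Nat.cast_injective
  have hneg : Summable fun n : ℕ => g (-(n + 1 : ℤ)) :=
    hs.summable.comp_injective (i := fun n : ℕ => -(n + 1 : ℤ)) (fun a b hab => by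
      simpa using hab)
  have e0 : quasiInterp h (cosMode k) x = ∑' n : ℕ, g n + ∑' n : ℕ, g (-(n + 1 : ℤ)) := by
    rw [← hs.tsum_eq]; exact tsum_of_nat_of_neg_add_one hpos hneg
  have e1 := hpos.sum_add_tsum_nat_add 2
  have e2 := hneg.sum_add_tsum_nat_add 2
  rw [Finset.sum_range_succ, Finset.sum_range_one] at e1 e2
  have t1 : |∑' n : ℕ, g ((n + 2 : ℕ) : ℤ)| ≤ 1000000 / 999999 * psiHat (2 + h * k) := by
    refine abs_tsum_tail_le (by linarith) fun n => (hgle _).trans (le_of_eq ?_)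
    congr 1
    push_cast; ring
  have t2 : |∑' n : ℕ, g (-((n + 2 : ℕ) + 1 : ℤ))|
      ≤ 1000000 / 999999 * psiHat (2 + (1 - h * k)) := by
    refine abs_tsum_tail_le (by linarith) fun n => (hgle _).trans (le_of_eq ?_)
    rw [← psiHat_neg]
    congr 1
    push_cast; ring
  have hsum : psiHat (2 + h * k) + psiHat (2 + (1 - h * k)) ≤ 1.01 * psiHat 2 := by
    have h52 : psiHat (5 / 2) ≤ 0.01 * psiHat 2 := by
      have : psiHat (5 / 2) ≤ psiHat 2 * psiHat 1 := by
        rw [psiHat_mul, psiHat]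
        apply Real.exp_le_exp.2
        nlinarith [sq_nonneg Real.pi]
      nlinarith [psiHat_one_le, psiHat_nonneg 2]
    rcases le_total (h * k) (1 / 2) with hk | hk
    · linarith [psiHat_anti (x := 2 + h * k) (y := 2) (by norm_num) (by linarith),
        psiHat_anti (x := 2 + (1 - h * k)) (y := 5 / 2) (by norm_num) (by linarith)]
    · linarith [psiHat_anti (x := 2 + h * k) (y := 5 / 2) (by norm_num) (by linarith),
        psiHat_anti (x := 2 + (1 - h * k)) (y := 2) (by norm_num) (by linarith)]
  have g0 : g ((0 : ℕ) : ℤ) = psiHat (h * k) * cosMode k x := by simp [hg]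
  have g1 : g ((1 : ℕ) : ℤ) = psiHat (h * k + 1) * cosMode (k + 1 / h) x := by simp [hg]
  have g2 : g (-((0 : ℕ) + 1 : ℤ)) = psiHat (h * k - 1) * cosMode (k - 1 / h) x := by
    simp only [hg]; push_cast; ring_nf
  have g3 : g (-((1 : ℕ) + 1 : ℤ)) = psiHat (h * k - 2) * cosMode (k - 2 / h) x := by
    simp only [hg]; push_cast; ring_nf
  rw [e0, ← e1, ← e2, g0, g1, g2, g3]
  have := abs_add_le (∑' n : ℕ, g ((n + 2 : ℕ) : ℤ)) (∑' n : ℕ, g (-((n + 2 : ℕ) + 1 : ℤ)))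
  calc _ = |∑' n : ℕ, g ((n + 2 : ℕ) : ℤ) + ∑' n : ℕ, g (-((n + 2 : ℕ) + 1 : ℤ))| := by
        congr 1; ring
    _ ≤ _ := by linarith [psiHat_nonneg 2]

theorem cosMode_zero : cosMode 0 = fun _ => 1 := by ext x; simp [cosMode]

theorem abs_quasiInterp_one_sub_one_le {h : ℝ} (hh : h ≠ 0) (x : ℝ) :
    |quasiInterp h (fun _ => 1) x - 1| ≤ constA - 2 := by
  have key := abs_quasiInterp_cosMode_sub_le (h := h) (k := 0) hh (by simp) (by simp) x
  rw [cosMode_zero] at key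
  simp only [mul_zero, zero_sub, zero_add, psiHat_neg, psiHat_zero, one_mul] at key
  have c1 : |psiHat 2 * cosMode (-(2 / h)) x| ≤ psiHat 2 := by
    rw [abs_mul, abs_of_nonneg (psiHat_nonneg _)]
    exact mul_le_of_le_one_right (psiHat_nonneg _) (abs_cosMode_le _ _)
  have c2 : |psiHat 1 * cosMode (-(1 / h)) x| ≤ psiHat 1 := by
    rw [abs_mul, abs_of_nonneg (psiHat_nonneg _)]
    exact mul_le_of_le_one_right (psiHat_nonneg _) (abs_cosMode_le _ _)
  have c3 : |psiHat 1 * cosMode (1 / h) x| ≤ psiHat 1 := by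
    rw [abs_mul, abs_of_nonneg (psiHat_nonneg _)]
    exact mul_le_of_le_one_right (psiHat_nonneg _) (abs_cosMode_le _ _)
  have h2 := psiHat_two_le
  have h1 := psiHat_nonneg 1
  rw [abs_le] at *
  unfold constA
  constructor <;> linarith

theorem abs_quasiError_one_le {h : ℝ} (hh : h ≠ 0) (x : ℝ) :
    |quasiError h (fun _ => 1) x| ≤ constA - 2 := by
  rw [quasiError, abs_sub_comm]
  exact abs_quasiInterp_one_sub_one_le hh x

theorem abs_quasiInterp_le {h : ℝ} (hh : h ≠ 0) {f : ℝ → ℝ} {C : ℝ} (hf : ∀ x, |f x| ≤ C) (x : ℝ) :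
    |quasiInterp h f x| ≤ (constA - 1) * C := by
  have hC : 0 ≤ C := (abs_nonneg _).trans (hf 0)
  have hs : HasSum (fun l : ℤ => C * psi (x / h - l)) (C * ∑' l : ℤ, psi (x / h - l)) :=
    (summable_psi (x / h)).hasSum.mul_left C
  have h1 := tsum_of_norm_bounded (f := fun l : ℤ => f (h * l) * psi (x / h - l)) hs fun l => by
    rw [Real.norm_eq_abs, abs_mul, abs_of_nonneg (psi_nonneg _)]
    exact mul_le_mul_of_nonneg_right (hf _) (psi_nonneg _)
  have h2 := abs_quasiInterp_one_sub_one_le hh x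
  simp only [quasiInterp, one_mul] at h2
  rw [abs_le] at h2
  rw [Real.norm_eq_abs] at h1
  rw [mul_comm]
  exact h1.trans (mul_le_mul_of_nonneg_left (by linarith) hC)

theorem abs_quasiError_le {h : ℝ} (hh : h ≠ 0) {f : ℝ → ℝ} {C : ℝ} (hf : ∀ x, |f x| ≤ C) (x : ℝ) :
    |quasiError h f x| ≤ constA * C := by
  have := abs_sub (f x) (quasiInterp h f x)
  unfold quasiError
  linarith [hf x, abs_quasiInterp_le hh hf x]

/-! ### Linearity on bounded functions -/

/-- Boundedness of a real function. -/
def IsBdd (f : ℝ → ℝ) : Prop := ∃ C, ∀ x, |f x| ≤ C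

theorem isBdd_cosMode (k : ℝ) : IsBdd (cosMode k) := ⟨1, abs_cosMode_le k⟩

theorem IsBdd.add {f g : ℝ → ℝ} (hf : IsBdd f) (hg : IsBdd g) : IsBdd fun x => f x + g x := by
  obtain ⟨C, hC⟩ := hf
  obtain ⟨D, hD⟩ := hg
  exact ⟨C + D, fun x => (abs_add_le _ _).trans (add_le_add (hC x) (hD x))⟩

theorem IsBdd.const_mul {f : ℝ → ℝ} (c : ℝ) (hf : IsBdd f) : IsBdd fun x => c * f x := by
  obtain ⟨C, hC⟩ := hf
  exact ⟨|c| * C, fun x => by rw [abs_mul]; exact mul_le_mul_of_nonneg_left (hC x) (abs_nonneg c)⟩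

theorem IsBdd.sub {f g : ℝ → ℝ} (hf : IsBdd f) (hg : IsBdd g) : IsBdd fun x => f x - g x := by
  simpa [sub_eq_add_neg] using hf.add (hg.const_mul (-1))

theorem IsBdd.sum {ι : Type*} {s : Finset ι} {f : ι → ℝ → ℝ} (hf : ∀ i ∈ s, IsBdd (f i)) :
    IsBdd fun x => ∑ i ∈ s, f i x := by
  classical
  induction s using Finset.induction_on with
  | empty => exact ⟨0, by simp⟩
  | insert a s ha ih =>
    simp only [Finset.sum_insert ha]
    exact (hf a (Finset.mem_insert_self a s)).add (ih fun i hi => hf i (Finset.mem_insert_of_mem hi))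

theorem IsBdd.quasiError {h : ℝ} (hh : h ≠ 0) {f : ℝ → ℝ} (hf : IsBdd f) :
    IsBdd (quasiError h f) := by
  obtain ⟨C, hC⟩ := hf
  exact ⟨_, abs_quasiError_le hh hC⟩

theorem quasiInterp_add {f g : ℝ → ℝ} (hf : IsBdd f) (hg : IsBdd g) (h x : ℝ) :
    quasiInterp h (fun x => f x + g x) x = quasiInterp h f x + quasiInterp h g x := by
  obtain ⟨C, hC⟩ := hf
  obtain ⟨D, hD⟩ := hg
  simp only [quasiInterp, add_mul]
  exact (summable_mul_psi (fun l => hC (h * l)) _).tsum_add (summable_mul_psi (fun l => hD (h * l)) _)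

theorem quasiInterp_const_mul (c : ℝ) (f : ℝ → ℝ) (h x : ℝ) :
    quasiInterp h (fun x => c * f x) x = c * quasiInterp h f x := by
  simp only [quasiInterp, mul_assoc, tsum_mul_left]

theorem quasiInterp_sum {ι : Type*} {s : Finset ι} {f : ι → ℝ → ℝ} (hf : ∀ i ∈ s, IsBdd (f i))
    (h x : ℝ) :
    quasiInterp h (fun x => ∑ i ∈ s, f i x) x = ∑ i ∈ s, quasiInterp h (f i) x := by
  classical
  induction s using Finset.induction_on with
  | empty => simp [quasiInterp]
  | insert a s ha ih =>
    simp only [Finset.sum_insert ha]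
    have h1 : ∀ i ∈ s, IsBdd (f i) := fun i hi => hf i (Finset.mem_insert_of_mem hi)
    rw [quasiInterp_add (hf a (Finset.mem_insert_self a s)) (IsBdd.sum h1), ih h1]

theorem quasiError_add {f g : ℝ → ℝ} (hf : IsBdd f) (hg : IsBdd g) (h : ℝ) :
    quasiError h (fun x => f x + g x) = fun x => quasiError h f x + quasiError h g x := by
  ext x
  rw [quasiError, quasiInterp_add hf hg, quasiError, quasiError]
  ring

theorem quasiError_const_mul (c : ℝ) (f : ℝ → ℝ) (h : ℝ) :
    quasiError h (fun x => c * f x) = fun x => c * quasiError h f x := by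
  ext x
  rw [quasiError, quasiInterp_const_mul, quasiError]
  ring

theorem IsBdd.multilevelError {h : ℝ} (hh : h ≠ 0) {f : ℝ → ℝ} (hf : IsBdd f) (p : ℕ) :
    IsBdd (multilevelError h p f) := by
  induction p with
  | zero => exact hf
  | succ p ih => exact ih.quasiError (by positivity)

theorem multilevelError_add {h : ℝ} (hh : h ≠ 0) {f g : ℝ → ℝ} (hf : IsBdd f) (hg : IsBdd g)
    (p : ℕ) : multilevelError h p (fun x => f x + g x)
      = fun x => multilevelError h p f x + multilevelError h p g x := by
  induction p with
  | zero => rfl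
  | succ p ih =>
    rw [multilevelError, ih, quasiError_add (hf.multilevelError hh p) (hg.multilevelError hh p)]
    rfl

theorem multilevelError_const_mul (c h : ℝ) (f : ℝ → ℝ) (p : ℕ) :
    multilevelError h p (fun x => c * f x) = fun x => c * multilevelError h p f x := by
  induction p with
  | zero => rfl
  | succ p ih => rw [multilevelError, ih, quasiError_const_mul]; rfl

theorem multilevelError_sub {h : ℝ} (hh : h ≠ 0) {f g : ℝ → ℝ} (hf : IsBdd f) (hg : IsBdd g)
    (p : ℕ) : multilevelError h p (fun x => f x - g x)
      = fun x => multilevelError h p f x - multilevelError h p g x := by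
  have h1 : (fun x => f x - g x) = fun x => f x + (-1) * g x := by ext x; ring
  rw [h1, multilevelError_add hh hf (hg.const_mul (-1)), multilevelError_const_mul]
  ext x; ring

theorem multilevelError_sum {h : ℝ} (hh : h ≠ 0) {ι : Type*} {s : Finset ι} {f : ι → ℝ → ℝ}
    (hf : ∀ i ∈ s, IsBdd (f i)) (p : ℕ) :
    multilevelError h p (fun x => ∑ i ∈ s, f i x)
      = fun x => ∑ i ∈ s, multilevelError h p (f i) x := by
  classical
  induction s using Finset.induction_on with
  | empty =>
    have := multilevelError_const_mul 0 h (fun _ => 0) p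
    simpa using this
  | insert a s ha ih =>
    simp only [Finset.sum_insert ha]
    have h1 : ∀ i ∈ s, IsBdd (f i) := fun i hi => hf i (Finset.mem_insert_of_mem hi)
    rw [multilevelError_add hh (hf a (Finset.mem_insert_self a s)) (IsBdd.sum h1), ih h1]

theorem abs_multilevelError_le {h : ℝ} (hh : h ≠ 0) {f : ℝ → ℝ} {C : ℝ} (hf : ∀ x, |f x| ≤ C)
    (p : ℕ) (x : ℝ) : |multilevelError h p f x| ≤ constA ^ p * C := by
  induction p generalizing x with
  | zero => simpa [multilevelError] using hf x
  | succ p ih =>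
    rw [multilevelError, pow_succ', mul_assoc]
    exact abs_quasiError_le (by positivity) ih x

theorem multilevelError_succ' (h : ℝ) (f : ℝ → ℝ) (p : ℕ) :
    multilevelError h (p + 1) f = multilevelError (h / 2) p (quasiError h f) := by
  induction p with
  | zero => simp [multilevelError]
  | succ p ih =>
    rw [multilevelError, ih, multilevelError]
    congr 1
    rw [pow_succ', div_div]

/-! ### Decay of the truncation norm -/

/-- The weight of the Lyapunov functional that controls the truncation coefficients. -/
noncomputable def weight (x : ℝ) : ℝ :=
  if x ≤ 1 / 8 then 1 else if x ≤ 1 / 4 then 1.78 else if x ≤ 1 / 2 then 4.6 else 20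

theorem one_le_weight (x : ℝ) : 1 ≤ weight x := by
  unfold weight; split_ifs <;> norm_num

theorem weight_le (x : ℝ) : weight x ≤ 20 := by
  unfold weight; split_ifs <;> norm_num

theorem weight_le_of_le_half {x : ℝ} (hx : x ≤ 1 / 2) : weight x ≤ 4.6 := by
  unfold weight; split_ifs <;> norm_num

theorem weight_le_of_le_quarter {x : ℝ} (hx : x ≤ 1 / 4) : weight x ≤ 1.78 := by
  unfold weight; split_ifs <;> norm_num

theorem weight_of_le_eighth {x : ℝ} (hx : x ≤ 1 / 8) : weight x = 1 := if_pos hx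

/-- One refinement step, applied to a coefficient at position `x`, contracts the weight. -/
theorem weight_step {x : ℝ} (h0 : 0 ≤ x) (h1 : x ≤ 1) :
    weight (x / 2) * (1 - psiHat x) + weight (1 - x / 2) * psiHat (2 - x)
      + weight ((1 - x) / 2) * psiHat (1 - x) + weight ((1 + x) / 2) * psiHat (1 + x)
      ≤ 0.4 * weight x := by
  have t1 : weight (1 - x / 2) * psiHat (2 - x) ≤ 20 * (1 / 1000000) :=
    mul_le_mul (weight_le _) ((psiHat_anti (by norm_num) (by linarith)).trans psiHat_one_le)
      (psiHat_nonneg _) (by norm_num)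
  have t2 : weight ((1 + x) / 2) * psiHat (1 + x) ≤ 20 * (1 / 1000000) :=
    mul_le_mul (weight_le _) ((psiHat_anti (by norm_num) (by linarith)).trans psiHat_one_le)
      (psiHat_nonneg _) (by norm_num)
  have hp : 0 ≤ 1 - psiHat x := sub_nonneg.2 (psiHat_le_one x)
  by_cases c1 : x ≤ 1 / 8
  · have e1 : weight (x / 2) = 1 := weight_of_le_eighth (by linarith)
    have e2 : weight ((1 - x) / 2) * psiHat (1 - x) ≤ 4.6 * (1 / 10000) :=
      mul_le_mul (weight_le_of_le_half (by linarith))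
        ((psiHat_anti (by norm_num) (by linarith)).trans psiHat_three_quarters_le)
        (psiHat_nonneg _) (by norm_num)
    have e3 : psiHat (1 / 8) ≤ psiHat x := psiHat_anti h0 c1
    rw [weight_of_le_eighth c1, e1]
    linarith [le_psiHat_eighth]
  by_cases c2 : x ≤ 1 / 4
  · have e1 : weight (x / 2) = 1 := weight_of_le_eighth (by linarith)
    have e2 : weight ((1 - x) / 2) * psiHat (1 - x) ≤ 4.6 * (1 / 10000) :=
      mul_le_mul (weight_le_of_le_half (by linarith))
        ((psiHat_anti (by norm_num) (by linarith)).trans psiHat_three_quarters_le)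
        (psiHat_nonneg _) (by norm_num)
    have e3 : psiHat (1 / 4) ≤ psiHat x := psiHat_anti h0 c2
    have e4 : weight x = 1.78 := by rw [weight, if_neg c1, if_pos c2]
    rw [e1, e4]
    linarith [le_psiHat_quarter]
  by_cases c3 : x ≤ 1 / 2
  · have e1 : weight (x / 2) * (1 - psiHat x) ≤ 1.78 * 1 :=
      mul_le_mul (weight_le_of_le_quarter (by linarith)) (by linarith [psiHat_nonneg x]) hp
        (by norm_num)
    have e2 : weight ((1 - x) / 2) * psiHat (1 - x) ≤ 4.6 * (13 / 1000) :=
      mul_le_mul (weight_le_of_le_half (by linarith))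
        ((psiHat_anti (by norm_num) (by linarith)).trans psiHat_half_le)
        (psiHat_nonneg _) (by norm_num)
    have e4 : weight x = 4.6 := by rw [weight, if_neg c1, if_neg c2, if_pos c3]
    rw [e4]
    linarith
  · have e1 : weight (x / 2) * (1 - psiHat x) ≤ 4.6 * 1 :=
      mul_le_mul (weight_le_of_le_half (by linarith)) (by linarith [psiHat_nonneg x]) hp
        (by norm_num)
    have e2 : weight ((1 - x) / 2) * psiHat (1 - x) ≤ 1.78 * 1 :=
      mul_le_mul (weight_le_of_le_quarter (by linarith)) (psiHat_le_one _)
        (psiHat_nonneg _) (by norm_num)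
    have e4 : weight x = 20 := by rw [weight, if_neg c1, if_neg c2, if_neg c3]
    rw [e4]
    linarith

/-- The Lyapunov functional of a pair of coefficients `(b, a)` at position `x`. -/
noncomputable def pairWeight (x b a : ℝ) : ℝ := weight x * |a| + weight (1 - x) * |b|

theorem pairWeight_step {x : ℝ} (h0 : 0 ≤ x) (h1 : x ≤ 1) (b a : ℝ) :
    pairWeight (x / 2) (-(b + a) * psiHat (x - 2)) (a - (b + a) * psiHat x)
      + pairWeight ((1 + x) / 2) (b - (b + a) * psiHat (x - 1)) (-(b + a) * psiHat (x + 1))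
      ≤ 0.4 * pairWeight x b a := by
  have sa := mul_le_mul_of_nonneg_right (weight_step h0 h1) (abs_nonneg a)
  have sb := mul_le_mul_of_nonneg_right
    (weight_step (x := 1 - x) (by linarith) (by linarith)) (abs_nonneg b)
  rw [show (1 - (1 - x)) / 2 = x / 2 by ring, show 1 - (1 - x) = x by ring,
    show 1 + (1 - x) = 2 - x by ring, show 2 - (1 - x) = 1 + x by ring,
    show 1 - (1 - x) / 2 = (1 + x) / 2 by ring, show (2 - x) / 2 = 1 - x / 2 by ring] at sb
  have p1 : psiHat (x - 2) = psiHat (2 - x) := by rw [← psiHat_neg]; congr 1; ring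
  have p2 : psiHat (x - 1) = psiHat (1 - x) := by rw [← psiHat_neg]; congr 1; ring
  have hab := abs_add_le b a
  have n1 : |-(b + a) * psiHat (x - 2)| ≤ (|b| + |a|) * psiHat (2 - x) := by
    rw [abs_mul, abs_neg, p1, abs_of_nonneg (psiHat_nonneg _)]
    exact mul_le_mul_of_nonneg_right hab (psiHat_nonneg _)
  have n2 : |-(b + a) * psiHat (x + 1)| ≤ (|b| + |a|) * psiHat (1 + x) := by
    rw [abs_mul, abs_neg, add_comm x 1, abs_of_nonneg (psiHat_nonneg _)]
    exact mul_le_mul_of_nonneg_right hab (psiHat_nonneg _)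
  have n3 : |a - (b + a) * psiHat x| ≤ |a| * (1 - psiHat x) + |b| * psiHat x := by
    have : a - (b + a) * psiHat x = a * (1 - psiHat x) - b * psiHat x := by ring
    rw [this]
    refine (abs_sub _ _).trans (le_of_eq ?_)
    rw [abs_mul, abs_mul, abs_of_nonneg (psiHat_nonneg _),
      abs_of_nonneg (sub_nonneg.2 (psiHat_le_one x))]
  have n4 : |b - (b + a) * psiHat (x - 1)| ≤ |b| * (1 - psiHat (1 - x)) + |a| * psiHat (1 - x) := by
    have : b - (b + a) * psiHat (x - 1) = b * (1 - psiHat (1 - x)) - a * psiHat (1 - x) := by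
      rw [p2]; ring
    rw [this]
    refine (abs_sub _ _).trans (le_of_eq ?_)
    rw [abs_mul, abs_mul, abs_of_nonneg (psiHat_nonneg _),
      abs_of_nonneg (sub_nonneg.2 (psiHat_le_one _))]
  have w : ∀ z, 0 ≤ weight z := fun z => zero_le_one.trans (one_le_weight z)
  have m1 := mul_le_mul_of_nonneg_left n1 (w (1 - x / 2))
  have m2 := mul_le_mul_of_nonneg_left n2 (w ((1 + x) / 2))
  have m3 := mul_le_mul_of_nonneg_left n3 (w (x / 2))
  have m4 := mul_le_mul_of_nonneg_left n4 (w ((1 - x) / 2))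
  unfold pairWeight
  rw [show 1 - (1 + x) / 2 = (1 - x) / 2 by ring]
  linarith

theorem sum_range_two_pow_succ (p : ℕ) (F : ℕ → ℝ) :
    ∑ j ∈ Finset.range (2 ^ (p + 1)), F j = ∑ j ∈ Finset.range (2 ^ p), (F j + F (2 ^ p + j)) := by
  rw [pow_succ, mul_two, Finset.sum_range_add, Finset.sum_add_distrib]

theorem truncCoeff_succ_low (y : ℝ) {p j : ℕ} (hj : j < 2 ^ p) :
    (truncCoeff y (p + 1)).1 j =
        -((truncCoeff y p).1 j + (truncCoeff y p).2 j) * psiHat ((y + j) / 2 ^ p - 2) ∧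
      (truncCoeff y (p + 1)).2 j = (truncCoeff y p).2 j -
        ((truncCoeff y p).1 j + (truncCoeff y p).2 j) * psiHat ((y + j) / 2 ^ p) := by
  simp [truncCoeff, hj]

theorem truncCoeff_succ_high (y : ℝ) (p j : ℕ) :
    (truncCoeff y (p + 1)).1 (2 ^ p + j) = (truncCoeff y p).1 j -
        ((truncCoeff y p).1 j + (truncCoeff y p).2 j) * psiHat ((y + j) / 2 ^ p - 1) ∧
      (truncCoeff y (p + 1)).2 (2 ^ p + j) =
        -((truncCoeff y p).1 j + (truncCoeff y p).2 j) * psiHat ((y + j) / 2 ^ p + 1) := by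
  simp [truncCoeff]

theorem position_mem {y : ℝ} (h0 : 0 ≤ y) (h1 : y ≤ 1) {p j : ℕ} (hj : j < 2 ^ p) :
    0 ≤ (y + j) / 2 ^ p ∧ (y + j) / 2 ^ p ≤ 1 := by
  refine ⟨by positivity, ?_⟩
  rw [div_le_one (by positivity)]
  have : (j : ℝ) + 1 ≤ 2 ^ p := by exact_mod_cast hj
  linarith

theorem sum_pairWeight_le {y : ℝ} (h0 : 0 ≤ y) (h1 : y ≤ 1) (p : ℕ) :
    ∑ j ∈ Finset.range (2 ^ p),
      pairWeight ((y + j) / 2 ^ p) ((truncCoeff y p).1 j) ((truncCoeff y p).2 j)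
      ≤ weight y * 0.4 ^ p := by
  induction p with
  | zero => simp [pairWeight, truncCoeff]
  | succ p ih =>
    rw [sum_range_two_pow_succ, pow_succ (0.4 : ℝ), ← mul_assoc, mul_comm _ (0.4 : ℝ)]
    refine le_trans ?_ (mul_le_mul_of_nonneg_left ih (by norm_num))
    rw [Finset.mul_sum]
    refine Finset.sum_le_sum fun j hj => ?_
    have hj := Finset.mem_range.1 hj
    obtain ⟨k0, k1⟩ := position_mem h0 h1 hj
    rw [(truncCoeff_succ_low y hj).1, (truncCoeff_succ_low y hj).2,
      (truncCoeff_succ_high y p j).1, (truncCoeff_succ_high y p j).2]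
    have q1 : (y + j) / 2 ^ (p + 1) = (y + j) / 2 ^ p / 2 := by rw [pow_succ, div_div]
    have q2 : (y + (2 ^ p + j : ℕ)) / 2 ^ (p + 1) = (1 + (y + j) / 2 ^ p) / 2 := by
      push_cast; rw [pow_succ]; field_simp; ring
    rw [q1, q2]
    exact pairWeight_step k0 k1 _ _

theorem truncNorm_le {y : ℝ} (h0 : 0 ≤ y) (h1 : y ≤ 1 / 2) (p : ℕ) :
    truncNorm y p ≤ 4.6 * 0.4 ^ p := by
  refine le_trans (Finset.sum_le_sum fun j _ => ?_) ((sum_pairWeight_le h0 (by linarith) p).trans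
    (mul_le_mul_of_nonneg_right (weight_le_of_le_half h1) (by positivity)))
  unfold pairWeight
  have := mul_le_mul_of_nonneg_right (one_le_weight ((y + j) / 2 ^ p)) (abs_nonneg ((truncCoeff y p).2 j))
  have := mul_le_mul_of_nonneg_right (one_le_weight (1 - (y + j) / 2 ^ p)) (abs_nonneg ((truncCoeff y p).1 j))
  linarith

theorem truncNorm_one_le {y : ℝ} (h0 : 0 ≤ y) (h1 : y ≤ 1 / 2) : truncNorm y 1 ≤ 1.01 := by
  obtain ⟨e1, e2, e3, e4⟩ := truncCoeff_one y
  rw [truncNorm, pow_one, Finset.sum_range_succ, Finset.sum_range_one, e1, e2, e3, e4, abs_neg,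
    abs_neg, abs_neg, abs_of_nonneg (psiHat_nonneg _), abs_of_nonneg (psiHat_nonneg _),
    abs_of_nonneg (psiHat_nonneg _), abs_of_nonneg (sub_nonneg.2 (psiHat_le_one y))]
  have a1 : psiHat (y - 1) ≤ psiHat y := psiHat_le_of_sq_le (by nlinarith)
  have a2 : psiHat (y + 1) ≤ psiHat 1 := psiHat_le_of_sq_le (by nlinarith)
  have a3 : psiHat (y - 2) ≤ psiHat 1 := psiHat_le_of_sq_le (by nlinarith)
  linarith [psiHat_one_le]

theorem truncNorm_zero (y : ℝ) : truncNorm y 0 = 1 := by simp [truncNorm, truncCoeff]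

theorem truncNorm_le_pow {y : ℝ} (h0 : 0 ≤ y) (h1 : y ≤ 1 / 2) (p : ℕ) :
    truncNorm y p ≤ constA ^ p := by
  match p with
  | 0 => simp [truncNorm_zero]
  | 1 => rw [pow_one]; linarith [truncNorm_one_le h0 h1, constA_ge_two]
  | p + 2 =>
    have h2 : (0.4 : ℝ) ^ p ≤ 1 := pow_le_one₀ (by norm_num) (by norm_num)
    have h3 : 1 ≤ constA ^ (p + 2) := one_le_pow₀ (by linarith [constA_ge_two])
    have h4 := truncNorm_le h0 h1 (p + 2)
    rw [pow_add] at h4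
    linarith

theorem isTruncConst_of_le {B : ℝ} (hB : 4.6 ≤ B) : IsTruncConst B := by
  intro l hl m hm p _
  have hm' : (m : ℝ) + 1 ≤ 2 ^ (l - 1) := by exact_mod_cast hm
  have hl' : (2 : ℝ) ^ l = 2 ^ (l - 1) * 2 := by rw [← pow_succ]; congr 1; omega
  have hy : 1 / 2 ^ l * (m : ℝ) ≤ 1 / 2 := by
    rw [one_div_mul_eq_div, div_le_div_iff₀ (by positivity) (by norm_num), hl']
    linarith
  refine (truncNorm_le (by positivity) hy p).trans ?_
  gcongr
  norm_num

/-! ### A lower bound for truncation constants -/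

theorem truncCoeff_snd_zero_ge (y : ℝ) (p : ℕ) :
    ((truncCoeff y p).1 0 ≤ 0 ∧ 0 ≤ (truncCoeff y p).1 0 + (truncCoeff y p).2 0) →
    ((truncCoeff y (p + 1)).1 0 ≤ 0 ∧
      (truncCoeff y p).2 0 * (1 - psiHat (y / 2 ^ p)) ≤ (truncCoeff y (p + 1)).2 0) := by
  rintro ⟨h1, h2⟩
  obtain ⟨e1, e2⟩ := truncCoeff_succ_low y (p := p) (j := 0) (by positivity)
  simp only [Nat.cast_zero, add_zero] at e1 e2
  rw [e1, e2]
  constructor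
  · nlinarith [psiHat_nonneg (y / 2 ^ p - 2)]
  · nlinarith [psiHat_nonneg (y / 2 ^ p)]

theorem IsTruncConst.ge {B : ℝ} (hB : IsTruncConst B) : 0.23 ≤ B := by
  have key := hB 8 (by norm_num) 127 (by norm_num) 3 le_rfl
  obtain ⟨y, hy⟩ : ∃ y : ℝ, y = 127 / 256 := ⟨_, rfl⟩
  rw [show (1 / 2 ^ 8 * ((127 : ℕ) : ℝ) : ℝ) = y by rw [hy]; norm_num] at key
  have u0 : psiHat y ≤ 0.02 :=
    (psiHat_le_inv_pow _ (n := 32) (by norm_num)).trans (by norm_num [hy])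
  have u1 : psiHat (y / 2) ≤ 0.31 :=
    (psiHat_le_inv_pow _ (n := 64) (by norm_num)).trans (by norm_num [hy])
  have u2 : psiHat (y / 4) ≤ 0.75 :=
    (psiHat_le_inv_pow _ (n := 16) (by norm_num)).trans (by norm_num [hy])
  obtain ⟨e1, -, e3, -⟩ := truncCoeff_one y
  have a1 : psiHat (y - 2) ≤ 1 / 1000000 :=
    (psiHat_le_of_sq_le (by norm_num [hy])).trans psiHat_one_le
  have s1 := truncCoeff_snd_zero_ge y 1
    ⟨by rw [e1]; linarith [psiHat_nonneg (y - 2)], by rw [e1, e3]; linarith⟩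
  rw [pow_one, e3] at s1
  obtain ⟨f1, -⟩ := truncCoeff_succ_low y (p := 1) (j := 0) (by norm_num)
  have a2 : psiHat ((y + (0 : ℕ)) / 2 ^ 1 - 2) ≤ 1 / 1000000 :=
    (psiHat_le_of_sq_le (by norm_num [hy])).trans psiHat_one_le
  rw [e1, e3] at f1
  have g1 : 0.676 ≤ (truncCoeff y 2).2 0 := by nlinarith [s1.2]
  have s2 := truncCoeff_snd_zero_ge y 2 ⟨s1.1, by
    have : -0.01 ≤ (truncCoeff y (1 + 1)).1 0 := by
      rw [f1]
      nlinarith [psiHat_nonneg (y - 2), psiHat_nonneg y, psiHat_nonneg ((y + (0 : ℕ)) / 2 ^ 1 - 2)]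
    norm_num at this
    linarith⟩
  have g2 : 0.1689 ≤ (truncCoeff y 3).2 0 := by
    have := s2.2
    norm_num at this
    nlinarith
  have g3 : (truncCoeff y 3).2 0 ≤ truncNorm y 3 := by
    refine le_trans ?_ (Finset.single_le_sum (f := fun j => |(truncCoeff y 3).2 j| +
      |(truncCoeff y 3).1 j|) (fun j _ => by positivity) (Finset.mem_range.2 (by norm_num : 0 < 2 ^ 3)))
    linarith [le_abs_self ((truncCoeff y 3).2 0), abs_nonneg ((truncCoeff y 3).1 0)]
  norm_num at key
  linarith

/-! ### The central truncation of the multilevel error of a cosine -/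

/-- The central truncation `T_{h,p} c_m`. -/
noncomputable def truncFun (h m : ℝ) (p : ℕ) (x : ℝ) : ℝ :=
  ∑ j ∈ Finset.range (2 ^ p), ((truncCoeff (h * m) p).1 j * cosMode (m - (2 ^ p - j) / h) x
    + (truncCoeff (h * m) p).2 j * cosMode (m + j / h) x)

theorem abs_truncFun_le (h m : ℝ) (p : ℕ) (x : ℝ) : |truncFun h m p x| ≤ truncNorm (h * m) p := by
  refine (Finset.abs_sum_le_sum_abs _ _).trans (Finset.sum_le_sum fun j _ => ?_)
  rw [add_comm |_|]
  refine (abs_add_le _ _).trans (add_le_add ?_ ?_) <;> rw [abs_mul] <;>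
    exact mul_le_of_le_one_right (abs_nonneg _) (abs_cosMode_le _ _)

theorem quasiInterp_congr {h : ℝ} {f g : ℝ → ℝ} (hfg : ∀ l : ℤ, f (h * l) = g (h * l)) :
    quasiInterp h f = quasiInterp h g := by
  ext x
  simp only [quasiInterp, hfg]

theorem cosMode_alias {h : ℝ} (hh : h ≠ 0) (k : ℝ) (n l : ℤ) :
    cosMode (k + n / h) (h * l) = cosMode k (h * l) := by
  unfold cosMode
  rw [show 2 * Real.pi * (k + n / h) * (h * l)
    = 2 * Real.pi * k * (h * l) + ((n * l : ℤ) : ℝ) * (2 * Real.pi) by push_cast; field_simp,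
    Real.cos_add_int_mul_two_pi]

theorem quasiInterp_cosMode_alias {h : ℝ} (hh : h ≠ 0) (k : ℝ) :
    quasiInterp h (cosMode (k - 1 / h)) = quasiInterp h (cosMode k) :=
  quasiInterp_congr fun l => by
    have := cosMode_alias hh k (-1) l
    rwa [Int.cast_neg, Int.cast_one, neg_div, ← sub_eq_add_neg] at this

theorem truncFun_zero {h m : ℝ} : truncFun h m 0 = cosMode m := by
  ext x; simp [truncFun, truncCoeff]

theorem isBdd_truncFun (h m : ℝ) (p : ℕ) : IsBdd (truncFun h m p) := ⟨_, abs_truncFun_le h m p⟩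

theorem abs_quasiError_truncFun_sub_le {h m : ℝ} (hh : 0 < h) (h0 : 0 ≤ h * m) (h1 : h * m ≤ 1 / 2)
    (p : ℕ) (x : ℝ) :
    |quasiError (h / 2 ^ p) (truncFun h m p) x - truncFun h m (p + 1) x|
      ≤ truncNorm (h * m) p * (11 / 10 * psiHat 2) := by
  set k : ℕ → ℝ := fun j => m + j / h with hk
  set b := (truncCoeff (h * m) p).1 with hb
  set a := (truncCoeff (h * m) p).2 with ha
  set η := h / 2 ^ p with hη
  have hη0 : η ≠ 0 := by positivity
  have hinv : 1 / η = 2 ^ p / h := by rw [hη, one_div_div]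
  have hpos : ∀ j : ℕ, η * k j = (h * m + j) / 2 ^ p := fun j => by
    rw [hη, hk]; field_simp
  have hT : truncFun h m p = fun x => ∑ j ∈ Finset.range (2 ^ p),
      (b j * cosMode (k j - 1 / η) x + a j * cosMode (k j) x) := by
    ext x
    refine Finset.sum_congr rfl fun j _ => ?_
    rw [hinv, hk]
    congr 3
    ring
  have hQ : quasiInterp η (truncFun h m p) x
      = ∑ j ∈ Finset.range (2 ^ p), (b j + a j) * quasiInterp η (cosMode (k j)) x := by
    rw [hT, quasiInterp_sum fun j _ => ((isBdd_cosMode _).const_mul _).add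
      ((isBdd_cosMode _).const_mul _)]
    refine Finset.sum_congr rfl fun j _ => ?_
    rw [quasiInterp_add ((isBdd_cosMode _).const_mul _) ((isBdd_cosMode _).const_mul _),
      quasiInterp_const_mul, quasiInterp_const_mul, quasiInterp_cosMode_alias hη0]
    ring
  have hT' : truncFun h m (p + 1) x = truncFun h m p x - ∑ j ∈ Finset.range (2 ^ p), (b j + a j) *
      (psiHat (η * k j - 2) * cosMode (k j - 2 / η) x
        + psiHat (η * k j - 1) * cosMode (k j - 1 / η) x
        + psiHat (η * k j) * cosMode (k j) x
        + psiHat (η * k j + 1) * cosMode (k j + 1 / η) x) := by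
    rw [hT, truncFun, sum_range_two_pow_succ, ← Finset.sum_sub_distrib]
    refine Finset.sum_congr rfl fun j hj => ?_
    rw [(truncCoeff_succ_low (h * m) (Finset.mem_range.1 hj)).1,
      (truncCoeff_succ_low (h * m) (Finset.mem_range.1 hj)).2,
      (truncCoeff_succ_high (h * m) p j).1, (truncCoeff_succ_high (h * m) p j).2, hpos]
    have f1 : m - (2 ^ (p + 1) - (j : ℝ)) / h = k j - 2 / η := by
      rw [show 2 / η = 2 * (1 / η) by ring, hinv, hk, pow_succ]; ring
    have f2 : m - (2 ^ (p + 1) - ((2 ^ p + j : ℕ) : ℝ)) / h = k j - 1 / η := by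
      rw [hinv, hk, pow_succ]; push_cast; ring
    have f3 : m + ((2 ^ p + j : ℕ) : ℝ) / h = k j + 1 / η := by
      rw [hinv, hk]; push_cast; ring
    rw [f1, f2, f3]
    ring
  rw [quasiError, hQ, hT', sub_sub_sub_cancel_left, ← Finset.sum_sub_distrib, truncNorm,
    Finset.sum_mul]
  refine (Finset.abs_sum_le_sum_abs _ _).trans (Finset.sum_le_sum fun j hj => ?_)
  obtain ⟨k0, k1⟩ := position_mem h0 (by linarith) (Finset.mem_range.1 hj)
  rw [← mul_sub, abs_mul, abs_sub_comm]
  refine mul_le_mul ?_ (abs_quasiInterp_cosMode_sub_le hη0 (by rwa [hpos]) (by rwa [hpos]) x)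
    (abs_nonneg _) (by positivity)
  rw [add_comm |_|]
  exact abs_add_le _ _

theorem abs_multilevelError_cosMode_sub_truncFun_le {h m : ℝ} (hh : 0 < h) (h0 : 0 ≤ h * m)
    (h1 : h * m ≤ 1 / 2) (p : ℕ) (x : ℝ) :
    |multilevelError h p (cosMode m) x - truncFun h m p x|
      ≤ p * constA ^ p / 2 * (11 / 10 * psiHat 2) := by
  induction p generalizing x with
  | zero => simp [truncFun_zero, multilevelError]
  | succ p ih =>
    have hb := (isBdd_cosMode m).multilevelError hh.ne' p
    have e := quasiError_add (hb.sub (isBdd_truncFun h m p)) (isBdd_truncFun h m p) (h / 2 ^ p)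
    simp only [sub_add_cancel] at e
    have e' : multilevelError h (p + 1) (cosMode m) x = _ := congrFun e x
    have s1 := abs_quasiError_le (h := h / 2 ^ p) (by positivity) ih x
    have s2 := abs_quasiError_truncFun_sub_le hh h0 h1 p x
    have hA := constA_ge_two
    have hE : 0 ≤ 11 / 10 * psiHat 2 := by linarith [psiHat_nonneg 2]
    have s3 := mul_le_mul_of_nonneg_right (truncNorm_le_pow h0 h1 p) hE
    have hAp : 0 ≤ constA ^ p := by positivity
    rw [e', add_sub_assoc]
    refine (abs_add_le _ _).trans ?_
    have : constA ^ p * (11 / 10 * psiHat 2) ≤ constA * constA ^ p / 2 * (11 / 10 * psiHat 2) :=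
      mul_le_mul_of_nonneg_right (by nlinarith) hE
    rw [pow_succ']
    push_cast
    nlinarith

/-- Levels resolving the frequency: the multilevel error is controlled by the truncation. -/
theorem abs_multilevelError_cosMode_le {h m : ℝ} (hh : 0 < h) (h0 : 0 ≤ h * m)
    (h1 : h * m ≤ 1 / 2) (p : ℕ) (x : ℝ) :
    |multilevelError h p (cosMode m) x|
      ≤ truncNorm (h * m) p + p * constA ^ p / 2 * (11 / 10 * psiHat 2) := by
  have s1 := abs_multilevelError_cosMode_sub_truncFun_le hh h0 h1 p x
  have s2 := abs_truncFun_le h m p x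
  have := abs_add_le (multilevelError h p (cosMode m) x - truncFun h m p x) (truncFun h m p x)
  rw [sub_add_cancel] at this
  linarith

/-! ### Cosines of arbitrary frequency -/

/-- Replacing a frequency by one that agrees with it on the grid. -/
theorem multilevelError_cosMode_eq {h : ℝ} (hh : h ≠ 0) {k m : ℝ}
    (hkm : ∀ l : ℤ, cosMode k (h * l) = cosMode m (h * l)) (p : ℕ) (x : ℝ) :
    multilevelError h (p + 1) (cosMode k) x = multilevelError (h / 2) p (cosMode k) x
      - multilevelError (h / 2) p (cosMode m) x + multilevelError h (p + 1) (cosMode m) x := by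
  have e : quasiError h (cosMode k)
      = fun x => (cosMode k x - cosMode m x) + quasiError h (cosMode m) x := by
    ext x
    rw [quasiError, quasiInterp_congr hkm, quasiError]
    ring
  have hh2 : h / 2 ≠ 0 := by positivity
  rw [multilevelError_succ', multilevelError_succ', e,
    multilevelError_add hh2 ((isBdd_cosMode k).sub (isBdd_cosMode m))
      ((isBdd_cosMode m).quasiError hh),
    multilevelError_sub hh2 (isBdd_cosMode k) (isBdd_cosMode m)]

/-- Every frequency agrees on the grid of spacing `2^{-j}` with one that the grid resolves. -/
theorem exists_resolved_alias (k j : ℕ) : ∃ m : ℕ, 2 * m ≤ 2 ^ j ∧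
    ∀ l : ℤ, cosMode k (1 / 2 ^ j * l) = cosMode m (1 / 2 ^ j * l) := by
  have hd := Nat.div_add_mod k (2 ^ j)
  have hlt := Nat.mod_lt k (show 0 < 2 ^ j by positivity)
  have hh : (1 / 2 ^ j : ℝ) ≠ 0 := by positivity
  generalize k % 2 ^ j = r at hd hlt
  generalize k / 2 ^ j = q at hd
  have hk : (k : ℝ) = r + (q : ℤ) / (1 / 2 ^ j) := by
    rw [← hd]; push_cast; rw [div_div_eq_mul_div, div_one]; ring
  have e1 : ∀ l : ℤ, cosMode k (1 / 2 ^ j * l) = cosMode r (1 / 2 ^ j * l) := fun l => by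
    rw [hk, cosMode_alias hh]
  by_cases hr : 2 * r ≤ 2 ^ j
  · exact ⟨r, hr, e1⟩
  · refine ⟨2 ^ j - r, by omega, fun l => ?_⟩
    rw [e1, Nat.cast_sub hlt.le]
    have : cosMode ((2 ^ j : ℕ) - r : ℝ) (1 / 2 ^ j * l)
        = cosMode (r + (-1 : ℤ) / (1 / 2 ^ j)) (1 / 2 ^ j * l) := by
      unfold cosMode
      rw [← Real.cos_neg]
      congr 1
      push_cast
      rw [div_div_eq_mul_div, div_one]
      ring
    rw [this, cosMode_alias hh]

/-- A bound, in terms of the number `q` of levels, for a frequency that is resolved once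
`r` levels are left; `n` bounds the truncation norms. -/
theorem abs_multilevelError_unresolved_le {n H : ℕ → ℝ} {r : ℕ}
    (hn : ∀ q, r ≤ q → ∀ y : ℝ, 0 ≤ y → y ≤ 1 / 2 → truncNorm y q ≤ n q)
    (hr : n r ≤ H r) (hH : ∀ q, r ≤ q → H q + n q + n (q + 1) ≤ H (q + 1))
    {p k : ℕ} (hk : 2 * k ≤ 2 ^ (p - r)) {q : ℕ} (hrq : r ≤ q) (hqp : q ≤ p) (x : ℝ) :
    |multilevelError (1 / 2 ^ (p - q)) q (cosMode k) x|
      ≤ H q + 3 / 2 * q * constA ^ q * (11 / 10 * psiHat 2) := by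
  have hE : 0 ≤ 11 / 10 * psiHat 2 := by linarith [psiHat_nonneg 2]
  have hA := constA_ge_two
  have resolved : ∀ (m j q : ℕ), 2 * m ≤ 2 ^ j → r ≤ q →
      |multilevelError (1 / 2 ^ j) q (cosMode m) x|
        ≤ n q + q * constA ^ q / 2 * (11 / 10 * psiHat 2) := by
    intro m j q hm hq
    have hm' : 2 * (m : ℝ) ≤ 2 ^ j := by exact_mod_cast hm
    have h1 : 1 / 2 ^ j * (m : ℝ) ≤ 1 / 2 := by
      rw [one_div_mul_eq_div, div_le_div_iff₀ (by positivity) (by norm_num)]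
      linarith
    have h0 : 0 ≤ 1 / 2 ^ j * (m : ℝ) := by positivity
    exact (abs_multilevelError_cosMode_le (by positivity) h0 h1 q x).trans
      (add_le_add_left (hn q hq _ h0 h1) _)
  induction q, hrq using Nat.le_induction with
  | base =>
    refine (resolved k (p - r) r hk le_rfl).trans ?_
    have : 0 ≤ (r : ℝ) * constA ^ r * (11 / 10 * psiHat 2) := by positivity
    linarith
  | succ q hrq ih =>
    obtain ⟨m, hm, hkm⟩ := exists_resolved_alias k (p - (q + 1))
    have hj : p - q = p - (q + 1) + 1 := by omega
    have hhalf : (1 / 2 ^ (p - (q + 1)) / 2 : ℝ) = 1 / 2 ^ (p - q) := by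
      rw [hj, pow_succ, div_div]
    rw [multilevelError_cosMode_eq (by positivity) hkm, hhalf]
    have i1 := ih (by omega)
    have i2 := resolved m (p - q) q (by rw [hj, pow_succ]; omega) hrq
    have i3 := resolved m (p - (q + 1)) (q + 1) hm (by omega)
    have i4 := hH q hrq
    have t : |multilevelError (1 / 2 ^ (p - q)) q (cosMode k) x
        - multilevelError (1 / 2 ^ (p - q)) q (cosMode m) x
        + multilevelError (1 / 2 ^ (p - (q + 1))) (q + 1) (cosMode m) x| ≤ _ :=
      (abs_add_le _ _).trans (add_le_add_left (abs_sub _ _) _)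
    have hz : 0 ≤ constA ^ q * (11 / 10 * psiHat 2) := by positivity
    set z := constA ^ q * (11 / 10 * psiHat 2)
    have h3 : 0 ≤ (q : ℝ) := by positivity
    have e1 : 3 / 2 * (q : ℝ) * constA ^ q * (11 / 10 * psiHat 2) = 3 / 2 * q * z := by ring
    have e2 : (q : ℝ) * constA ^ q / 2 * (11 / 10 * psiHat 2) = q * z / 2 := by ring
    have e3 : ((q + 1 : ℕ) : ℝ) * constA ^ (q + 1) / 2 * (11 / 10 * psiHat 2)
        = (q + 1) * (constA * z) / 2 := by push_cast; ring
    have e4 : 3 / 2 * ((q + 1 : ℕ) : ℝ) * constA ^ (q + 1) * (11 / 10 * psiHat 2)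
        = 3 / 2 * (q + 1) * (constA * z) := by push_cast; ring
    rw [e1] at i1
    rw [e2] at i2
    rw [e3] at i3
    rw [e4]
    have : 2 * z ≤ constA * z := mul_le_mul_of_nonneg_right hA hz
    nlinarith

/-- Low frequencies: those resolved once `r ≥ 1` levels are left. -/
theorem abs_multilevelError_one_low_le {r p k : ℕ} (hr : 1 ≤ r) (hrp : r ≤ p)
    (hk : 2 * k ≤ 2 ^ (p - r)) (x : ℝ) :
    |multilevelError 1 p (cosMode k) x|
      ≤ 4.98 * 0.9 ^ r + 3 / 2 * p * constA ^ p * (11 / 10 * psiHat 2) := by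
  rcases hr.eq_or_lt with rfl | hr
  · have key := abs_multilevelError_unresolved_le (r := 1)
      (n := fun q => if q = 1 then 1.01 else 4.6 * 0.4 ^ q)
      (H := fun q => if q = 1 then 1.01 else 2.02 + 46 / 3 * 0.16 - 161 / 15 * 0.4 ^ q)
      (fun q _ y h0 h1 => by
        split_ifs with h
        · subst h; exact truncNorm_one_le h0 h1
        · exact truncNorm_le h0 h1 q)
      le_rfl
      (fun q hq => by
        rcases hq.eq_or_lt with rfl | hq
        · norm_num
        · simp only [show q ≠ 1 by omega, show q + 1 ≠ 1 by omega, if_false]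
          rw [pow_succ]
          linarith)
      hk hrp le_rfl x
    rw [Nat.sub_self, pow_zero, div_one] at key
    refine key.trans (add_le_add_left ?_ _)
    split_ifs
    · norm_num
    · have : (0 : ℝ) ≤ 0.4 ^ p := by positivity
      linarith
  · have key := abs_multilevelError_unresolved_le (r := r)
      (n := fun q => 4.6 * 0.4 ^ q)
      (H := fun q => 46 / 3 * 0.4 ^ r - 161 / 15 * 0.4 ^ q)
      (fun q _ y h0 h1 => truncNorm_le h0 h1 q)
      (by linarith)
      (fun q hq => by rw [pow_succ]; linarith)
      hk hrp le_rfl x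
    rw [Nat.sub_self, pow_zero, div_one] at key
    refine key.trans (add_le_add_left ?_ _)
    obtain ⟨i, rfl⟩ := Nat.exists_eq_add_of_le hr
    have h1 : (0 : ℝ) ≤ 0.4 ^ p := by positivity
    have h2 : (0.4 : ℝ) ^ i ≤ 0.9 ^ i := by gcongr; norm_num
    have h3 : (0 : ℝ) ≤ 0.9 ^ i := by positivity
    rw [pow_add, pow_add]
    linarith

theorem abs_multilevelError_one_le {h : ℝ} (hh : h ≠ 0) (p : ℕ) (x : ℝ) :
    |multilevelError h (p + 1) (cosMode 0) x| ≤ constA ^ p * (constA - 2) := by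
  rw [multilevelError_succ', cosMode_zero]
  exact abs_multilevelError_le (by positivity) (abs_quasiError_one_le hh) p x

/-- A bound for all frequencies. -/
theorem abs_multilevelError_one_high_le (k : ℕ) {p : ℕ} (hp : 1 ≤ p) (x : ℝ) :
    |multilevelError 1 p (cosMode k) x| ≤ constA ^ p / Real.sqrt 2 + 1.5 * 0.4 ^ p := by
  have h2 : (0.7071 : ℝ) ≤ 1 / Real.sqrt 2 := by
    rw [le_div_iff₀ (by positivity)]
    nlinarith [Real.sq_sqrt (show (0 : ℝ) ≤ 2 by norm_num), Real.sqrt_nonneg 2]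
  have hA := constA_ge_two
  have hA' := constA_le
  rw [div_eq_mul_one_div]
  obtain ⟨p, rfl⟩ := Nat.exists_eq_add_of_le' hp
  rcases p with _ | p
  · have := abs_multilevelError_le (h := 1) one_ne_zero (abs_cosMode_le k) 1 x
    norm_num at this ⊢
    norm_num at h2
    nlinarith
  · have hkm : ∀ l : ℤ, cosMode k (1 * l) = cosMode 0 (1 * l) := fun l => by
      have := cosMode_alias one_ne_zero 0 k l
      simpa using this
    rw [multilevelError_cosMode_eq one_ne_zero hkm]
    have s1 := abs_multilevelError_le (h := 1 / 2) (by norm_num) (abs_cosMode_le k) (p + 1) x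
    have s2 := abs_multilevelError_one_le (h := 1 / 2) (by norm_num) p x
    have s3 := abs_multilevelError_one_le (h := 1) (by norm_num) (p + 1) x
    have t : |multilevelError (1 / 2) (p + 1) (cosMode k) x
        - multilevelError (1 / 2) (p + 1) (cosMode 0) x
        + multilevelError 1 (p + 1 + 1) (cosMode 0) x| ≤ _ :=
      (abs_add_le _ _).trans (add_le_add_left (abs_sub _ _) _)
    have hz : 0 ≤ constA ^ p := by positivity
    rw [pow_succ'] at s1 s3
    rw [pow_succ', pow_succ']
    have h4 : (0 : ℝ) ≤ 1.5 * 0.4 ^ (p + 1 + 1) := by positivity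
    generalize constA ^ p = z at *
    have q1 : z * (constA - 2) ≤ z * 0.00001 := mul_le_mul_of_nonneg_left (by linarith) hz
    have q2 : constA * z * (constA - 2) ≤ constA * z * 0.00001 :=
      mul_le_mul_of_nonneg_left (by linarith) (by positivity)
    have q3 : 2 * z ≤ constA * z := mul_le_mul_of_nonneg_right hA hz
    have q4 : constA * (constA * z) * 0.7071 ≤ constA * (constA * z) * (1 / Real.sqrt 2) :=
      mul_le_mul_of_nonneg_left h2 (by positivity)
    have q5 : 2 * (constA * z) ≤ constA * (constA * z) :=
      mul_le_mul_of_nonneg_right hA (by positivity)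
    linarith

/-! ### Weighted sums of coefficients -/

theorem sum_abs_mul_le {ρ g : ℕ → ℝ} {N G s : ℝ} {n : ℕ} (hN : 0 ≤ N)
    (hρ : ∑ k ∈ Finset.Ico 1 n, (k : ℝ) ^ (2 * s) * ρ k ^ 2 ≤ 2 * N ^ 2)
    (hG : ∑ k ∈ Finset.Ico 1 n, g k ^ 2 * (k : ℝ) ^ (-2 * s) ≤ G) :
    ∑ k ∈ Finset.Ico 1 n, |ρ k| * g k ≤ Real.sqrt 2 * N * Real.sqrt G := by
  have e : ∀ k ∈ Finset.Ico 1 n, |ρ k| * g k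
      = ((k : ℝ) ^ s * |ρ k|) * (g k * (k : ℝ) ^ (-s)) := by
    intro k hk
    have hk' : (0 : ℝ) < k := by exact_mod_cast (Finset.mem_Ico.1 hk).1
    rw [Real.rpow_neg hk'.le]
    field_simp
  have e1 : ∀ k : ℕ, ((k : ℝ) ^ s * |ρ k|) ^ 2 = (k : ℝ) ^ (2 * s) * ρ k ^ 2 := fun k => by
    rw [mul_pow, sq_abs, mul_comm 2 s, Real.rpow_mul (Nat.cast_nonneg k), Real.rpow_two]
  have e2 : ∀ k : ℕ, (g k * (k : ℝ) ^ (-s)) ^ 2 = g k ^ 2 * (k : ℝ) ^ (-2 * s) := fun k => by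
    rw [mul_pow, show -2 * s = -s * 2 by ring, Real.rpow_mul (Nat.cast_nonneg k), Real.rpow_two]
  rw [Finset.sum_congr rfl e]
  refine (Real.sum_mul_le_sqrt_mul_sqrt _ _ _).trans ?_
  simp only [e1, e2]
  have : Real.sqrt 2 * N = Real.sqrt (2 * N ^ 2) := by
    rw [Real.sqrt_mul (by norm_num), Real.sqrt_sq hN]
  rw [this]
  gcongr

theorem sum_rpow_neg_le {s : ℝ} (hs : 1 ≤ s) (n : ℕ) :
    ∑ k ∈ Finset.Ico 1 n, (k : ℝ) ^ (-2 * s) ≤ 2 := by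
  have h := sum_Ioo_inv_sq_le (α := ℝ) 0 n
  refine le_trans ?_ (h.trans (by norm_num))
  rw [show Finset.Ioo 0 n = Finset.Ico 1 n from rfl]
  refine Finset.sum_le_sum fun k hk => ?_
  have hk1 : (1 : ℝ) ≤ k := by exact_mod_cast (Finset.mem_Ico.1 hk).1
  rw [← Real.rpow_natCast, ← Real.rpow_neg (by linarith)]
  exact Real.rpow_le_rpow_of_exponent_le hk1 (by push_cast; linarith)

theorem sum_Ico_one_two_pow (F : ℕ → ℝ) (q : ℕ) :
    ∑ k ∈ Finset.Ico 1 (2 ^ q), F k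
      = ∑ l ∈ Finset.range q, ∑ k ∈ Finset.Ico (2 ^ l) (2 ^ (l + 1)), F k := by
  induction q with
  | zero => simp
  | succ q ih =>
    rw [Finset.sum_range_succ, ← ih, Finset.sum_Ico_consecutive _ Nat.one_le_two_pow
      (Nat.pow_le_pow_right (by norm_num) (Nat.le_succ q))]

theorem sum_low_le {s : ℝ} (hs : 0 ≤ s) (p : ℕ) :
    ∑ k ∈ Finset.Ico 1 (2 ^ (p - 2)), ((0.9 : ℝ) ^ (Nat.log 2 k + 2))⁻¹ ^ 2 * (k : ℝ) ^ (-2 * s)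
      ≤ ∑ l ∈ Finset.range (p - 2),
        ((0.9 : ℝ) ^ (2 * l + 4))⁻¹ * (2 : ℝ) ^ (-2 * (l : ℝ) * (s - 1 / 2)) := by
  rw [sum_Ico_one_two_pow]
  refine Finset.sum_le_sum fun l _ => ?_
  have hb : ∀ k ∈ Finset.Ico (2 ^ l) (2 ^ (l + 1)),
      ((0.9 : ℝ) ^ (Nat.log 2 k + 2))⁻¹ ^ 2 * (k : ℝ) ^ (-2 * s)
        ≤ ((0.9 : ℝ) ^ (2 * l + 4))⁻¹ * (2 : ℝ) ^ (-2 * (l : ℝ) * s) := by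
    intro k hk
    obtain ⟨k1, k2⟩ := Finset.mem_Ico.1 hk
    have hlog : Nat.log 2 k = l := by
      rw [Nat.log_eq_iff (Or.inr ⟨by norm_num, by have := Nat.two_pow_pos l; omega⟩)]
      exact ⟨k1, k2⟩
    rw [hlog, inv_pow, ← pow_mul, show (l + 2) * 2 = 2 * l + 4 by ring]
    refine mul_le_mul_of_nonneg_left ?_ (by positivity)
    rw [show -2 * (l : ℝ) * s = l * (-2 * s) by ring, Real.rpow_mul (x := 2) (by norm_num),
      Real.rpow_natCast]
    exact Real.rpow_le_rpow_of_nonpos (by positivity) (by exact_mod_cast k1) (by linarith)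
  refine (Finset.sum_le_card_nsmul _ _ _ hb).trans (le_of_eq ?_)
  rw [Nat.card_Ico, show 2 ^ (l + 1) - 2 ^ l = 2 ^ l by rw [pow_succ]; omega, nsmul_eq_mul]
  have : (2 : ℝ) ^ (-2 * (l : ℝ) * (s - 1 / 2)) = 2 ^ l * (2 : ℝ) ^ (-2 * (l : ℝ) * s) := by
    rw [← Real.rpow_natCast, ← Real.rpow_add (by norm_num)]
    congr 1; ring
  rw [this]
  push_cast
  ring

theorem sum_high_le {s t : ℝ} (ht : 1 / 2 < t) (hts : t < s) (p n : ℕ) :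
    ∑ k ∈ Finset.Ico 1 n, (if k < 2 ^ (p - 2) then (0 : ℝ) else 1) ^ 2 * (k : ℝ) ^ (-2 * s)
      ≤ (constC p t * (2 : ℝ) ^ (-((p : ℝ) - 2) * (s - t))) ^ 2 := by
  set F : ℕ → ℝ := fun k => if (2 : ℝ) ^ ((p : ℤ) - 2) ≤ k then (k : ℝ) ^ (-2 * t) else 0 with hF
  have hF0 : ∀ k, 0 ≤ F k := fun k => by rw [hF]; positivity
  have hsum : Summable F := by
    refine Summable.of_nonneg_of_le hF0 (fun k => ?_)
      (Real.summable_nat_rpow.2 (by linarith : -2 * t < -1))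
    rw [hF]
    dsimp only
    split_ifs
    · exact le_rfl
    · positivity
  rw [mul_pow, constC, Real.sq_sqrt (tsum_nonneg hF0), mul_comm (tsum _)]
  refine le_trans ?_ (mul_le_mul_of_nonneg_left (hsum.sum_le_tsum (Finset.Ico 1 n) fun k _ => hF0 k)
    (by positivity))
  rw [Finset.mul_sum]
  refine Finset.sum_le_sum fun k hk => ?_
  split_ifs with hlow
  · rw [zero_pow two_ne_zero, zero_mul]
    exact mul_nonneg (by positivity) (hF0 k)
  have hk1 : (1 : ℝ) ≤ k := by exact_mod_cast (Finset.mem_Ico.1 hk).1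
  have hk2 : (2 : ℝ) ^ ((p : ℤ) - 2) ≤ k := by
    have h1 : (2 : ℝ) ^ (p - 2) ≤ k := by exact_mod_cast not_lt.1 hlow
    refine le_trans ?_ h1
    rw [← zpow_natCast]
    exact zpow_le_zpow_right₀ (by norm_num) (by omega)
  have hFk : F k = (k : ℝ) ^ (-2 * t) := if_pos hk2
  rw [hFk, one_pow, one_mul, show -2 * s = -2 * (s - t) + -2 * t by ring,
    Real.rpow_add (by linarith)]
  refine mul_le_mul_of_nonneg_right ?_ (by positivity)
  have e : ((2 : ℝ) ^ (-((p : ℝ) - 2) * (s - t))) ^ 2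
      = ((2 : ℝ) ^ ((p : ℤ) - 2)) ^ (-2 * (s - t)) := by
    rw [← Real.rpow_two, ← Real.rpow_mul (by norm_num), ← Real.rpow_intCast,
      ← Real.rpow_mul (by norm_num)]
    congr 1
    push_cast
    ring
  rw [e]
  exact Real.rpow_le_rpow_of_nonpos (by positivity) hk2 (by linarith)

theorem psiHat_two_eq : 11 / 10 * psiHat 2 = 0.55 * eps := by unfold eps; ring

theorem mul_sqrt_three_le_rpow {p : ℕ} (hp : 3 ≤ p) :
    (p : ℝ) * Real.sqrt 3 ≤ (p : ℝ) ^ (3 / 2 : ℝ) := by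
  have h0 : (0 : ℝ) < p := by positivity
  rw [show (3 / 2 : ℝ) = 1 + 1 / 2 by norm_num, Real.rpow_add h0, Real.rpow_one,
    ← Real.sqrt_eq_rpow]
  have : (3 : ℝ) ≤ p := by exact_mod_cast hp
  gcongr

theorem natCast_le_rpow {p : ℕ} (hp : 1 ≤ p) : (p : ℝ) ≤ (p : ℝ) ^ (3 / 2 : ℝ) := by
  have h1 : (1 : ℝ) ≤ p := by exact_mod_cast hp
  conv_lhs => rw [← Real.rpow_one (p : ℝ)]
  exact Real.rpow_le_rpow_of_exponent_le h1 (by norm_num)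

/-- The bound for one cosine, split according to whether the frequency is low or high. -/
theorem abs_multilevelError_cosMode_split_le {p k : ℕ} (hp : 1 ≤ p) (hk : 1 ≤ k) (x : ℝ) :
    |multilevelError 1 p (cosMode k) x| ≤
      4.98 * 0.9 ^ p * (if k < 2 ^ (p - 2) then ((0.9 : ℝ) ^ (Nat.log 2 k + 2))⁻¹ else 0)
      + 3 / 2 * p * constA ^ p * (0.55 * eps) * (if k < 2 ^ (p - 2) then 1 else 0)
      + constA ^ p / Real.sqrt 2 * (if k < 2 ^ (p - 2) then 0 else 1)
      + 1.5 * 0.4 ^ p * 1 := by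
  split_ifs with h
  · have h1 : Nat.log 2 k < p - 2 := Nat.log_lt_of_lt_pow (by omega) h
    have h2 := Nat.lt_pow_succ_log_self (b := 2) (by norm_num) k
    have key := abs_multilevelError_one_low_le (r := p - (Nat.log 2 k + 2)) (p := p) (k := k)
      (by omega) (by omega) (by
        rw [show p - (p - (Nat.log 2 k + 2)) = Nat.log 2 k + 1 + 1 by omega,
          pow_succ 2 (Nat.log 2 k + 1)]
        omega) x
    have e : (0.9 : ℝ) ^ (p - (Nat.log 2 k + 2))
        = 0.9 ^ p * ((0.9 : ℝ) ^ (Nat.log 2 k + 2))⁻¹ :=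
      pow_sub₀ _ (by norm_num) (by omega)
    rw [e, psiHat_two_eq] at key
    have : (0 : ℝ) ≤ 0.4 ^ p := by positivity
    linarith
  · have := abs_multilevelError_one_high_le k hp x
    linarith

theorem eps_nonneg : 0 ≤ eps := by unfold eps; linarith [psiHat_nonneg 2]

theorem truncation_error_total_le {p : ℕ} (hp : 1 ≤ p) :
    p * constA ^ p / 2 * (0.55 * eps)
      + 3 / 2 * p * constA ^ p * (0.55 * eps) * (if 3 ≤ p then 2 else 0)
      ≤ 2 / Real.sqrt 3 * (p : ℝ) ^ (3 / 2 : ℝ) * constA ^ p * eps := by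
  have hAe : 0 ≤ constA ^ p * eps :=
    mul_nonneg (pow_nonneg (by linarith [constA_ge_two]) p) eps_nonneg
  have h3pos : 0 < Real.sqrt 3 := by positivity
  have q : ∀ c, c * p ≤ 2 / Real.sqrt 3 * (p : ℝ) ^ (3 / 2 : ℝ) → c * p * (constA ^ p * eps)
      ≤ 2 / Real.sqrt 3 * (p : ℝ) ^ (3 / 2 : ℝ) * constA ^ p * eps := fun c hc => by
    rw [mul_assoc _ (constA ^ p) eps]
    exact mul_le_mul_of_nonneg_right hc hAe
  split_ifs with h3
  · refine le_trans (le_of_eq ?_) (q 1.925 ?_)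
    · ring
    · have := mul_le_mul_of_nonneg_left (mul_sqrt_three_le_rpow h3)
        (show 0 ≤ 2 / Real.sqrt 3 by positivity)
      rw [show 2 / Real.sqrt 3 * (p * Real.sqrt 3) = 2 * p by field_simp] at this
      have hp0 : (0 : ℝ) ≤ p := by positivity
      linarith
  · refine le_trans (le_of_eq ?_) (q 0.275 ?_)
    · ring
    · have h1 : 1 ≤ 2 / Real.sqrt 3 := by
        rw [le_div_iff₀ h3pos, one_mul, Real.sqrt_le_left (by norm_num)]; norm_num
      have h2 := natCast_le_rpow hp
      have hp0 : (0 : ℝ) ≤ p := by positivity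
      nlinarith

theorem abs_multilevelError_sum_le_split {s t N : ℝ} (hs : 1 ≤ s) (ht : 1 / 2 < t)
    (hts : t < s) (hN : 0 ≤ N) {ρ : ℕ → ℝ} {n p : ℕ} (hp : 1 ≤ p) (h0 : |ρ 0| ≤ N)
    (hρ : ∑ k ∈ Finset.Ico 1 (n + 1), (k : ℝ) ^ (2 * s) * ρ k ^ 2 ≤ 2 * N ^ 2) (x : ℝ) :
    |multilevelError 1 p (fun x => ∑ k ∈ Finset.range (n + 1), ρ k * cosMode k x) x|
      ≤ N * (4.6 * 0.4 ^ p + p * constA ^ p / 2 * (0.55 * eps))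
        + (4.98 * 0.9 ^ p * (Real.sqrt 2 * N * constD p s)
        + 3 / 2 * p * constA ^ p * (0.55 * eps) * (if 3 ≤ p then 2 * N else 0)
        + constA ^ p / Real.sqrt 2 *
          (Real.sqrt 2 * N * (constC p t * (2 : ℝ) ^ (-((p : ℝ) - 2) * (s - t))))
        + 1.5 * 0.4 ^ p * (2 * N)) := by
  have hA := constA_ge_two
  have heps := eps_nonneg
  have hs2 : Real.sqrt 2 * Real.sqrt 2 = 2 := Real.mul_self_sqrt (by norm_num)
  have c1 := sum_abs_mul_le (G := constD p s ^ 2)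
    (g := fun k => if k < 2 ^ (p - 2) then ((0.9 : ℝ) ^ (Nat.log 2 k + 2))⁻¹ else 0) hN hρ (by
      rw [constD, Real.sq_sqrt (Finset.sum_nonneg fun l _ => by positivity)]
      refine le_trans ?_ (sum_low_le (by linarith) p)
      rw [← Finset.sum_filter_add_sum_filter_not _ (fun k => k < 2 ^ (p - 2))]
      rw [Finset.sum_eq_zero (s := Finset.filter (fun k => ¬ k < 2 ^ (p - 2)) _), add_zero]
      · rw [Finset.sum_congr rfl fun k hk => by rw [if_pos (Finset.mem_filter.1 hk).2]]
        refine Finset.sum_le_sum_of_subset_of_nonneg (fun k hk => ?_) fun k _ _ => by positivity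
        have := Finset.mem_filter.1 hk
        exact Finset.mem_Ico.2 ⟨(Finset.mem_Ico.1 this.1).1, this.2⟩
      · intro k hk
        rw [if_neg (Finset.mem_filter.1 hk).2, zero_pow two_ne_zero, zero_mul])
  have hind : ∀ k : ℕ, (if k < 2 ^ (p - 2) then (1 : ℝ) else 0) ^ 2 * (k : ℝ) ^ (-2 * s)
      ≤ (k : ℝ) ^ (-2 * s) := fun k => by
    split_ifs
    · simp
    · simp only [ne_eq, OfNat.ofNat_ne_zero, not_false_eq_true, zero_pow, zero_mul]; positivity
  have c2 := sum_abs_mul_le (G := 2) (g := fun k => if k < 2 ^ (p - 2) then 1 else 0) hN hρ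
    ((Finset.sum_le_sum fun k _ => hind k).trans (sum_rpow_neg_le hs (n + 1)))
  have c3 := sum_abs_mul_le (g := fun k => if k < 2 ^ (p - 2) then 0 else 1) hN hρ
    (sum_high_le ht hts p (n + 1))
  have c4 := sum_abs_mul_le (G := 2) (g := fun _ => 1) hN hρ
    (by simpa using sum_rpow_neg_le hs (n + 1))
  have hD : 0 ≤ constD p s := Real.sqrt_nonneg _
  have hC : 0 ≤ constC p t := Real.sqrt_nonneg _
  rw [Real.sqrt_sq hD] at c1
  rw [Real.sqrt_sq (by positivity)] at c3
  have c2' : ∑ k ∈ Finset.Ico 1 (n + 1), |ρ k| * (if k < 2 ^ (p - 2) then (1 : ℝ) else 0)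
      ≤ if 3 ≤ p then 2 * N else 0 := by
    split_ifs with h3
    · refine c2.trans (le_of_eq ?_)
      rw [mul_right_comm, hs2]
    · refine (Finset.sum_eq_zero fun k hk => ?_).le
      rw [if_neg, mul_zero]
      rw [show p - 2 = 0 by omega]
      have := (Finset.mem_Ico.1 hk).1
      omega
  have c4' : ∑ k ∈ Finset.Ico 1 (n + 1), |ρ k| * (1 : ℝ) ≤ 2 * N := by
    refine c4.trans (le_of_eq ?_)
    rw [mul_right_comm, hs2]
  have m0 : |multilevelError 1 p (cosMode (0 : ℕ)) x|
      ≤ 4.6 * 0.4 ^ p + p * constA ^ p / 2 * (0.55 * eps) := by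
    rw [← psiHat_two_eq]
    refine (abs_multilevelError_cosMode_le (h := 1) (m := (0 : ℕ)) one_pos (by simp) (by simp)
      p x).trans (add_le_add_left (truncNorm_le (by simp) (by simp) p) _)
  rw [multilevelError_sum one_ne_zero fun (k : ℕ) _ => (isBdd_cosMode (k : ℝ)).const_mul (ρ k)]
  refine (Finset.abs_sum_le_sum_abs _ _).trans ?_
  rw [Finset.range_eq_Ico, Finset.sum_eq_sum_Ico_succ_bot (Nat.succ_pos n)]
  simp only [multilevelError_const_mul, abs_mul]
  refine add_le_add (mul_le_mul h0 m0 (abs_nonneg _) hN) ?_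
  refine (Finset.sum_le_sum fun k hk => mul_le_mul_of_nonneg_left
    (abs_multilevelError_cosMode_split_le hp (Finset.mem_Ico.1 hk).1 x) (abs_nonneg _)).trans ?_
  refine le_trans (le_of_eq ?_) (add_le_add (add_le_add (add_le_add
    (mul_le_mul_of_nonneg_left c1 (by positivity))
    (mul_le_mul_of_nonneg_left c2' (by positivity)))
    (mul_le_mul_of_nonneg_left c3 (by positivity)))
    (mul_le_mul_of_nonneg_left c4' (by positivity)))
  simp only [Finset.mul_sum, ← Finset.sum_add_distrib]
  exact Finset.sum_congr rfl fun k _ => by ring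

/-- The error bound for a finite cosine sum. -/
theorem abs_multilevelError_sum_le {B s t N : ℝ} (hB : 0.23 ≤ B) (hs : 1 ≤ s) (ht : 1 / 2 < t)
    (hts : t < s) (hN : 0 ≤ N) {ρ : ℕ → ℝ} {n p : ℕ} (hp : 1 ≤ p) (h0 : |ρ 0| ≤ N)
    (hρ : ∑ k ∈ Finset.Ico 1 (n + 1), (k : ℝ) ^ (2 * s) * ρ k ^ 2 ≤ 2 * N ^ 2) (x : ℝ) :
    |multilevelError 1 p (fun x => ∑ k ∈ Finset.range (n + 1), ρ k * cosMode k x) x| ≤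
      (31 * B * (1 + constD p s) * 0.9 ^ p
        + constC p t * constA ^ p * (2 : ℝ) ^ (-((p : ℝ) - 2) * (s - t))
        + 2 / Real.sqrt 3 * (p : ℝ) ^ (3 / 2 : ℝ) * constA ^ p * eps) * N := by
  have hD : 0 ≤ constD p s := Real.sqrt_nonneg _
  have hs2' : Real.sqrt 2 ≤ 1.4143 := by
    rw [Real.sqrt_le_left (by norm_num)]; norm_num
  have hs2pos : 0 < Real.sqrt 2 := by positivity
  refine (abs_multilevelError_sum_le_split hs ht hts hN hp h0 hρ x).trans ?_
  have hpow : 7.6 * (0.4 : ℝ) ^ p ≤ 31 * B * 0.9 ^ p := by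
    obtain ⟨q, rfl⟩ := Nat.exists_eq_add_of_le' hp
    have h1 : (0.4 : ℝ) ^ q ≤ 0.9 ^ q := by gcongr; norm_num
    have h2 : (0 : ℝ) ≤ 0.9 ^ q := by positivity
    rw [pow_succ, pow_succ]
    nlinarith
  have hlow : 4.98 * (0.9 : ℝ) ^ p * (Real.sqrt 2 * constD p s) ≤ 31 * B * 0.9 ^ p * constD p s := by
    have : 4.98 * Real.sqrt 2 ≤ 31 * B := by linarith
    have h1 : (0 : ℝ) ≤ 0.9 ^ p * constD p s := by positivity
    nlinarith
  have heq : constA ^ p / Real.sqrt 2 *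
      (Real.sqrt 2 * N * (constC p t * (2 : ℝ) ^ (-((p : ℝ) - 2) * (s - t))))
      = constC p t * constA ^ p * (2 : ℝ) ^ (-((p : ℝ) - 2) * (s - t)) * N := by
    field_simp
  have hite : (if 3 ≤ p then 2 * N else 0) = (if 3 ≤ p then (2 : ℝ) else 0) * N := by
    split_ifs <;> simp
  rw [heq, hite]
  linarith [mul_le_mul_of_nonneg_right hpow hN, mul_le_mul_of_nonneg_right hlow hN,
    mul_le_mul_of_nonneg_right (truncation_error_total_le hp) hN]

/-! ### Cosine expansion of even functions in the Sobolev space -/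

theorem summable_norm_fourierCoef {s : ℝ} (hs : 1 ≤ s) {f : ℝ → ℝ} (hf : MemSobolev s f) :
    Summable fun k : ℤ => ‖fourierCoef f k‖ := by
  have h1 := hf.2.2
  have h2 : Summable fun k : ℤ => |(k : ℝ)| ^ (-(2 * s)) :=
    Real.summable_abs_int_rpow (by linarith)
  have h3 : Summable fun k : ℤ => if k = 0 then ‖fourierCoef f 0‖ else 0 :=
    (hasSum_ite_eq (0 : ℤ) _).summable
  refine Summable.of_nonneg_of_le (fun _ => norm_nonneg _) (fun k => ?_) ((h1.add h2).add h3)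
  rcases eq_or_ne k 0 with rfl | hk
  · rw [if_pos rfl]
    have : 0 ≤ |((0 : ℤ) : ℝ)| ^ (2 * s) * ‖fourierCoef f 0‖ ^ 2
      + |((0 : ℤ) : ℝ)| ^ (-(2 * s)) := by positivity
    linarith
  · rw [if_neg hk, add_zero, Real.rpow_neg (abs_nonneg _)]
    have hk' : 0 < |(k : ℝ)| := by positivity
    have hw : 0 < |(k : ℝ)| ^ s := by positivity
    have e : |(k : ℝ)| ^ (2 * s) = (|(k : ℝ)| ^ s) ^ 2 := by
      rw [mul_comm 2 s, Real.rpow_mul hk'.le, Real.rpow_two]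
    rw [e]
    set w := |(k : ℝ)| ^ s
    set c := ‖fourierCoef f k‖
    have hc : c = (w * c) * w⁻¹ := by field_simp
    have hnn : 0 ≤ (w * c) * w⁻¹ := by positivity
    rw [← inv_pow, ← mul_pow]
    nlinarith [two_mul_le_add_sq (w * c) w⁻¹]

theorem hasSum_fourierCoef {f : ℝ → ℝ} (hc : Continuous f) (hp : Function.Periodic f 1)
    (hs : Summable fun k : ℤ => ‖fourierCoef f k‖) (x : ℝ) :
    HasSum (fun k : ℤ => fourierCoef f k * Complex.exp (2 * Real.pi * Complex.I * k * x))
      (f x : ℂ) := by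
  have hp' : Function.Periodic (fun x => (f x : ℂ)) 1 := fun x => by simp only [hp x]
  let F : C(UnitAddCircle, ℂ) := ⟨hp'.lift, by
    refine Continuous.quotient_lift ?_ _
    exact Complex.continuous_ofReal.comp hc⟩
  have hFx : ∀ x : ℝ, F (x : UnitAddCircle) = f x := fun x => hp'.lift_coe x
  have hcoef : ∀ k : ℤ, fourierCoeff F k = fourierCoef f k := fun k => by
    rw [fourierCoeff_eq_intervalIntegral F k 0, fourierCoef]
    simp only [zero_add, div_one, one_smul]
    refine intervalIntegral.integral_congr fun x _ => ?_
    simp only [hFx, fourier_coe_apply, smul_eq_mul]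
    rw [mul_comm]
    congr 2
    push_cast
    ring
  have hsum : Summable (fourierCoeff F) := by
    refine Summable.of_norm ?_
    simpa only [hcoef] using hs
  have key := has_pointwise_sum_fourier_series_of_summable hsum (x : UnitAddCircle)
  rw [hFx] at key
  refine key.congr_fun fun k => ?_
  rw [hcoef, fourier_coe_apply, smul_eq_mul]
  congr 2
  push_cast
  ring

/-- The cosine coefficients of an even function. -/
noncomputable def cosCoef (f : ℝ → ℝ) (n : ℕ) : ℝ :=
  if n = 0 then (fourierCoef f 0).re else (fourierCoef f n).re + (fourierCoef f (-n)).re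

theorem hasSum_int_cosMode {f : ℝ → ℝ} (hc : Continuous f) (hev : ∀ x, f (-x) = f x)
    (hp : Function.Periodic f 1) (hs : Summable fun k : ℤ => ‖fourierCoef f k‖) (x : ℝ) :
    HasSum (fun k : ℤ => (fourierCoef f k).re * cosMode k x) (f x) := by
  have h1 := hasSum_fourierCoef hc hp hs x
  have h2 := hasSum_fourierCoef hc hp hs (-x)
  rw [hev] at h2
  have h3 := Complex.hasSum_re ((h1.add h2).div_const 2)
  rw [add_self_div_two, Complex.ofReal_re] at h3
  refine h3.congr_fun fun k => ?_
  have e : (fourierCoef f k * Complex.exp (2 * Real.pi * Complex.I * k * x)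
      + fourierCoef f k * Complex.exp (2 * Real.pi * Complex.I * k * (-x : ℝ))) / 2
      = fourierCoef f k * (cosMode k x : ℝ) := by
    rw [cosMode, Complex.ofReal_cos, Complex.cos]
    push_cast
    rw [show (2 * Real.pi * k * x * Complex.I : ℂ) = 2 * Real.pi * Complex.I * k * x by ring,
      show (-(2 * Real.pi * k * x) * Complex.I : ℂ) = 2 * Real.pi * Complex.I * k * -x by ring]
    ring
  rw [e, Complex.re_mul_ofReal]

theorem hasSum_cosCoef {f : ℝ → ℝ} (hc : Continuous f) (hev : ∀ x, f (-x) = f x)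
    (hp : Function.Periodic f 1) (hs : Summable fun k : ℤ => ‖fourierCoef f k‖) (x : ℝ) :
    HasSum (fun n : ℕ => cosCoef f n * cosMode n x) (f x) := by
  have h := (hasSum_int_cosMode hc hev hp hs x).nat_add_neg
  have h0 : HasSum (fun n : ℕ => if n = 0 then (fourierCoef f 0).re else 0) (fourierCoef f 0).re :=
    hasSum_ite_eq 0 _
  have h1 := h.sub h0
  simp only [Int.cast_zero, cosMode_zero, mul_one, add_sub_cancel_right] at h1
  refine h1.congr_fun fun n => ?_
  have hneg : cosMode ((-n : ℤ) : ℝ) x = cosMode n x := by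
    rw [cosMode, cosMode, ← Real.cos_neg]; congr 1; push_cast; ring
  rw [hneg, cosCoef]
  split_ifs with hn
  · subst hn; simp [cosMode_zero]
  · push_cast; ring

theorem summable_abs_cosCoef {f : ℝ → ℝ} (hs : Summable fun k : ℤ => ‖fourierCoef f k‖) :
    Summable fun n : ℕ => |cosCoef f n| := by
  have h := hs.hasSum.nat_add_neg.summable
  refine Summable.of_nonneg_of_le (fun _ => abs_nonneg _) (fun n => ?_) h
  rw [cosCoef]
  split_ifs with hn
  · subst hn
    have := Complex.abs_re_le_norm (fourierCoef f 0)
    simp only [Nat.cast_zero, neg_zero]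
    linarith [norm_nonneg (fourierCoef f 0)]
  · exact (abs_add_le _ _).trans (add_le_add (Complex.abs_re_le_norm _) (Complex.abs_re_le_norm _))

theorem sobolevNorm_sq {s : ℝ} (f : ℝ → ℝ) : sobolevNorm s f ^ 2
    = ‖fourierCoef f 0‖ ^ 2 + ∑' k : ℤ, |(k : ℝ)| ^ (2 * s) * ‖fourierCoef f k‖ ^ 2 :=
  Real.sq_sqrt (add_nonneg (by positivity) (tsum_nonneg fun k => by positivity))

theorem abs_cosCoef_zero_le (s : ℝ) (f : ℝ → ℝ) : |cosCoef f 0| ≤ sobolevNorm s f := by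
  rw [cosCoef, if_pos rfl]
  refine (Complex.abs_re_le_norm _).trans (Real.le_sqrt_of_sq_le ?_)
  have : 0 ≤ ∑' k : ℤ, |(k : ℝ)| ^ (2 * s) * ‖fourierCoef f k‖ ^ 2 :=
    tsum_nonneg fun k => by positivity
  linarith

theorem sum_cosCoef_sq_le {s : ℝ} (hs : 0 < s) {f : ℝ → ℝ} (hf : MemSobolev s f) (n : ℕ) :
    ∑ k ∈ Finset.Ico 1 n, (k : ℝ) ^ (2 * s) * cosCoef f k ^ 2 ≤ 2 * sobolevNorm s f ^ 2 := by
  set G : ℤ → ℝ := fun k => |(k : ℝ)| ^ (2 * s) * ‖fourierCoef f k‖ ^ 2 with hG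
  have hG0 : ∀ k, 0 ≤ G k := fun k => by rw [hG]; positivity
  have h := hf.2.2.hasSum.nat_add_neg
  have hz : |((0 : ℤ) : ℝ)| ^ (2 * s) * ‖fourierCoef f 0‖ ^ 2 = 0 := by
    rw [Int.cast_zero, abs_zero, Real.zero_rpow (by positivity), zero_mul]
  rw [hz, add_zero] at h
  have h1 := sum_le_hasSum (Finset.Ico 1 n) (fun k _ => add_nonneg (hG0 k) (hG0 (-k))) h
  rw [sobolevNorm_sq]
  have h2 : ∑ k ∈ Finset.Ico 1 n, (k : ℝ) ^ (2 * s) * cosCoef f k ^ 2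
      ≤ 2 * ∑ k ∈ Finset.Ico 1 n, (G k + G (-k)) := by
    rw [Finset.mul_sum]
    refine Finset.sum_le_sum fun k hk => ?_
    have hk0 : k ≠ 0 := by have := (Finset.mem_Ico.1 hk).1; omega
    simp only [hG, cosCoef, if_neg hk0]
    push_cast
    rw [abs_neg, Nat.abs_cast, ← mul_add, mul_left_comm]
    refine mul_le_mul_of_nonneg_left ?_ (by positivity)
    have a1 := sq_le_sq' (neg_le_of_abs_le (Complex.abs_re_le_norm (fourierCoef f k)))
      (le_of_abs_le (Complex.abs_re_le_norm (fourierCoef f k)))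
    have a2 := sq_le_sq' (neg_le_of_abs_le (Complex.abs_re_le_norm (fourierCoef f (-k))))
      (le_of_abs_le (Complex.abs_re_le_norm (fourierCoef f (-k))))
    nlinarith [sq_nonneg ((fourierCoef f k).re - (fourierCoef f (-k)).re)]
  have h3 : 0 ≤ ‖fourierCoef f 0‖ ^ 2 := by positivity
  linarith

theorem abs_multilevelError_le_of_partial_sums {f : ℝ → ℝ} {ρ : ℕ → ℝ} {p : ℕ} {x K : ℝ}
    (hρ : Summable fun n => |ρ n|) (hf : ∀ x, HasSum (fun n : ℕ => ρ n * cosMode n x) (f x))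
    (hK : ∀ n : ℕ,
      |multilevelError 1 p (fun x => ∑ k ∈ Finset.range (n + 1), ρ k * cosMode k x) x| ≤ K) :
    |multilevelError 1 p f x| ≤ K := by
  have htail : ∀ n x, |f x - ∑ k ∈ Finset.range n, ρ k * cosMode k x| ≤ ∑' k, |ρ (k + n)| := by
    intro n x
    have h1 := (hf x).summable.sum_add_tsum_nat_add n
    rw [(hf x).tsum_eq] at h1
    rw [← h1, add_sub_cancel_left, ← Real.norm_eq_abs]
    refine tsum_of_norm_bounded ((summable_nat_add_iff n).2 hρ).hasSum fun k => ?_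
    rw [Real.norm_eq_abs, abs_mul]
    exact mul_le_of_le_one_right (abs_nonneg _) (abs_cosMode_le _ _)
  have hlim : Filter.Tendsto (fun n => K + constA ^ p * ∑' k, |ρ (k + (n + 1))|) Filter.atTop
      (nhds (K + constA ^ p * 0)) :=
    (((tendsto_sum_nat_add fun k => |ρ k|).comp (Filter.tendsto_add_atTop_nat 1)).const_mul
      _).const_add K
  rw [mul_zero, add_zero] at hlim
  refine ge_of_tendsto' hlim fun n => ?_
  have hS : IsBdd fun x => ∑ k ∈ Finset.range (n + 1), ρ k * cosMode k x :=
    IsBdd.sum fun (k : ℕ) _ => (isBdd_cosMode (k : ℝ)).const_mul (ρ k)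
  have e := congrFun (multilevelError_add (h := 1) one_ne_zero
    (f := fun x => f x - ∑ k ∈ Finset.range (n + 1), ρ k * cosMode k x)
    ⟨_, htail (n + 1)⟩ hS p) x
  simp only [sub_add_cancel] at e
  rw [e, add_comm]
  exact (abs_add_le _ _).trans (add_le_add (hK n)
    (abs_multilevelError_le one_ne_zero (htail (n + 1)) p x))

end GaussianMultilevel

open GaussianMultilevel
theorem mainTheorem1 :
    (∃ B : ℝ, 0 < B ∧ IsTruncConst B) ∧
    ∀ B : ℝ, IsTruncConst B →
      ∀ s t : ℝ, 1 ≤ s → 1 / 2 < t → t < s →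
      ∀ f : ℝ → ℝ, Continuous f → (∀ x, f (-x) = f x) → MemSobolev s f →
      ∀ p : ℕ, 1 ≤ p → ∀ x : ℝ,
        |multilevelError 1 p f x| ≤
          (31 * B * (1 + constD p s) * 0.9 ^ p
            + constC p t * constA ^ p * (2 : ℝ) ^ (-((p : ℝ) - 2) * (s - t))
            + 2 / Real.sqrt 3 * (p : ℝ) ^ (3 / 2 : ℝ) * constA ^ p * eps) * sobolevNorm s f := by
  refine ⟨⟨4.6, by norm_num, isTruncConst_of_le le_rfl⟩, ?_⟩
  intro B hB s t hs ht hts f hc hev hf p hp x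
  have hsum := summable_norm_fourierCoef hs hf
  exact abs_multilevelError_le_of_partial_sums (summable_abs_cosCoef hsum)
    (hasSum_cosCoef hc hev hf.1 hsum) fun n =>
      abs_multilevelError_sum_le hB.ge hs ht hts (Real.sqrt_nonneg _) hp
        (abs_cosCoef_zero_le s f) (sum_cosCoef_sq_le (by linarith) hf (n + 1)) x
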